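/- **Conventions.** For a set $A$, an ordinal word on $A$ of length $\alpha$ is a function $w:\alpha\to A$; it is a limit word if $\alpha$ is a (nonzero) limit ordinal. $w^\beta$ is $w$ concatenated $\beta$ times (length $|w|\cdot\beta$), a final segment of $w$ is a word $u$ with $w=vu$ for some word $v$, and the contraction $\operatorname{ctr}(w)$ is obtained from $w$ by replacing each maximal block of consecutive equal letters by a single letter. For a natural number $n$ an *$n$-symbol limit rule operator* is a (class) function $\Gamma$ from the ordinal words on ${}^\omega n$ (histories of tape contents) to ${}^\omega n$ (tape contents). For a word $H$ on ${}^\omega n$ and $c\in\omega$, $H|_c$ is the word on $n$ giving the history of the cell $c$. The operator $\Gamma$ is *simulational* if it is * stable: $\Gamma(x^\alpha)=x$ for all $x\in{}^\omega n$ and all limit ordinals $\alpha$; * cell-by-cell: there is $\gamma$, from ordinal words on $n$ to $n$, with $\Gamma(H)[c]=\gamma(H|_c)$ for all limit words $H$ and all cells $c$; * asymptotic: $\Gamma(H)=\Gamma(H')$ for every limit word $H$ and every non-empty final segment $H'$ of $H$; * contraction-proof: $\Gamma(H)=\Gamma(H')$ for all limit words $H,H'$ with $\operatorname{ctr}(H)=\operatorname{ctr}(H')$.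 It is *looping stable* if $\Gamma(H^\alpha)=\Gamma(H^{\alpha'})$ for every limit word $H$ and all limit ordinals $\alpha,\alpha'$. The $2$-symbol operator $\Gamma_{\sup}$ gives a cell the value $0$ if and only if its history is eventually $0$, and $1$ otherwise. A *$\Gamma$-machine* has the structure of a finite Turing machine with three tapes (input, working, output) over the symbols $0,\dots,n-1$ and one head; at successor stages it computes as a finite Turing machine, and at each limit stage the head is on the first cell, the state is a distinguished limit state, and the tape content is $\Gamma(H)$ for $H$ the history of the tape content so far (the three tapes being coded in one element of ${}^\omega n$). A machine that has halted keeps its halting snapshot at all later stages. A *snapshot* consists of the state, the head position and the tape content. For $2\le n$, an $n$-symbol operator $\Gamma$ *emulates* $\Gamma_{\sup}$ if for each $\Gamma_{\sup}$-machine $m$ (classical infinite time Turing machine) there is a $\Gamma$-machine $m'$, whose states include those of $m$, with the same start, limit and halting states, such that on every input $y\in{}^\omega 2$: 1. at every limit stage the snapshots of $m$ and $m'$ are the same; 2. for every stage $\mu$ that is $0$ or a limit, the snapshots of $m$ at the stages $\mu+j$ ($j<\omega$) appear in the same order among those of $m'$ at the stages $\mu+i$ ($i<\omega$), starting with equality at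 $\mu$ itself, consecutive ones being separated by finitely many other snapshots of $m'$; 3. each of these other snapshots of $m'$ has a symbol $s\notin\{0,1\}$ in at least one of its cells. For a permutation $\sigma$ of the $n$ symbols, $\Gamma^\sigma$ denotes $\Gamma$ with each symbol $s$ renamed to $\sigma(s)$: $\Gamma^\sigma(H)=\sigma(\Gamma(\sigma^{-1}(H)))$, with $\sigma,\sigma^{-1}$ applied to every cell. **Proposition.** Let $n\ge 2$ and let $\Gamma$ be an $n$-symbol simulational and looping stable operator. Then, up to a renaming of the symbols, $\Gamma$ emulates $\Gamma_{\sup}$: there is a permutation $\sigma$ of the $n$ symbols such that $\Gamma^\sigma$ emulates $\Gamma_{\sup}$. -/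

import Mathlib

universe u

namespace InfTM

/-! ### Ordinal words -/

/-- An ordinal word on the alphabet `A`: a function from an ordinal `len` to `A`. -/
@[ext]
structure OrdWord (A : Type) : Type (u + 1) where
  /-- the length of the word -/
  len : Ordinal.{u}
  /-- the letter at each position `i < len` -/
  get : ∀ i : Ordinal.{u}, i < len → A

namespace OrdWord

variable {A B : Type}

/-- A limit word: its length is a (nonzero) limit ordinal. -/
def IsLimit (w : OrdWord.{u} A) : Prop := Order.IsSuccLimit w.len

/-- Apply a map to every letter. -/
def map (f : A → B) (w : OrdWord.{u} A) : OrdWord.{u} B where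
  len := w.len
  get i hi := f (w.get i hi)

/-- The word `x ^ α`, for a single letter `x`. -/
def const (x : A) (α : Ordinal.{u}) : OrdWord.{u} A where
  len := α
  get _ _ := x

/-- The word `w ^ α`: `w` concatenated `α` times to itself, of length `|w| * α`. The letter at
position `|w| * δ + ρ`, where `ρ < |w|`, is `w[ρ]`. -/
noncomputable def rep (w : OrdWord.{u} A) (α : Ordinal.{u}) : OrdWord.{u} A where
  len := w.len * α
  get i hi := w.get (i % w.len) (Ordinal.mod_lt i (by
    rintro h
    rw [h, zero_mul] at hi
    exact absurd hi (not_lt.mpr (zero_le))))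

/-- `u` is a final segment (suffix) of `w`. -/
def IsFinalSegment (u w : OrdWord.{u} A) : Prop :=
  ∃ α : Ordinal.{u}, α + u.len = w.len ∧
    ∀ (i : Ordinal.{u}) (hi : i < u.len) (hi' : α + i < w.len), u.get i hi = w.get (α + i) hi'

/-- The position `i` starts a block of equal letters of `w`: for no `κ < i` is `w` constant on
`[κ, i]`. -/
def IsBlockStart (w : OrdWord.{u} A) (i : Ordinal.{u}) (hi : i < w.len) : Prop :=
  ∀ κ < i, ∃ (ξ : Ordinal.{u}) (hξ : ξ < i), κ ≤ ξ ∧ w.get ξ (hξ.trans hi) ≠ w.get i hi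

/-- The increasing enumeration `ν₀ < ν₁ < …` of the block starts of `w`, followed by all the
ordinals that are not positions of `w`. -/
noncomputable def blockSeq (w : OrdWord.{u} A) : Ordinal.{u} → Ordinal.{u} :=
  Ordinal.enumOrd {i | ∀ hi : i < w.len, w.IsBlockStart i hi}

/-- The contraction of `w`: every block of equal letters is replaced by a single letter. -/
noncomputable def ctr (w : OrdWord.{u} A) : OrdWord.{u} A where
  len := sInf {μ | w.len ≤ w.blockSeq μ}
  get μ hμ := w.get (w.blockSeq μ) (lt_of_not_ge fun h =>
    notMem_of_lt_csInf' hμ h)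

end OrdWord

/-! ### Limit rule operators -/

/-- An `n`-symbol limit rule operator, from histories of tape contents to tape contents. -/
abbrev LimitOperator (n : ℕ) : Type (u + 1) := OrdWord.{u} (ℕ → Fin n) → (ℕ → Fin n)

namespace LimitOperator

variable {n : ℕ}

/-- `Γ (x ^ α) = x` for every tape content `x` and every limit ordinal `α`. -/
def Stable (Γ : LimitOperator.{u} n) : Prop :=
  ∀ (x : ℕ → Fin n) (α : Ordinal.{u}), Order.IsSuccLimit α → Γ (OrdWord.const x α) = x

/-- The limit value of a cell is a function, the same for all cells, of the history of that
cell. -/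
def CellByCell (Γ : LimitOperator.{u} n) : Prop :=
  ∃ γ : OrdWord.{u} (Fin n) → Fin n, ∀ H : OrdWord.{u} (ℕ → Fin n), H.IsLimit →
    ∀ c : ℕ, γ (H.map fun x => x c) = Γ H c

/-- A limit history and any of its non-empty final segments have the same limit. -/
def Asymptotic (Γ : LimitOperator.{u} n) : Prop :=
  ∀ H H' : OrdWord.{u} (ℕ → Fin n), H.IsLimit → H'.IsFinalSegment H → 0 < H'.len → Γ H = Γ H'

/-- Limit histories that are equal after contraction have the same limit. -/
def ContractionProof (Γ : LimitOperator.{u} n) : Prop :=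
  ∀ H H' : OrdWord.{u} (ℕ → Fin n), H.IsLimit → H'.IsLimit → H.ctr = H'.ctr → Γ H = Γ H'

/-- Simulational operators. -/
structure Simulational (Γ : LimitOperator.{u} n) : Prop where
  stable : Γ.Stable
  cellByCell : Γ.CellByCell
  asymptotic : Γ.Asymptotic
  contractionProof : Γ.ContractionProof

/-- Looping stability: `Γ (H ^ α) = Γ (H ^ α')` for every limit history `H` and all limit ordinals
`α` and `α'`. -/
def LoopingStable (Γ : LimitOperator.{u} n) : Prop :=
  ∀ (H : OrdWord.{u} (ℕ → Fin n)) (α α' : Ordinal.{u}), H.IsLimit → Order.IsSuccLimit α →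
    Order.IsSuccLimit α' → Γ (H.rep α) = Γ (H.rep α')

/-- The operator `Γ` after renaming each symbol `s` to `σ s`. -/
def rename (σ : Equiv.Perm (Fin n)) (Γ : LimitOperator.{u} n) : LimitOperator.{u} n :=
  fun H c => σ (Γ (H.map fun x d => σ.symm (x d)) c)

open Classical in
/-- The two-symbol `limsup` operator: the value of a cell is `0` if and only if the cell has
stabilized on `0`. -/
noncomputable def sup : LimitOperator.{u} 2 := fun H c =>
  if ∃ β < H.len, ∀ (δ : Ordinal.{u}) (hδ : δ < H.len), β ≤ δ → H.get δ hδ c = 0 then 0 else 1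

end LimitOperator

/-! ### Machines -/

/-- Moves of the head. -/
inductive Move : Type
  | left
  | stay
  | right

/-- A position of the head after a move (a left move on the first cell leaves the head there). -/
def Move.apply : Move → ℕ → ℕ
  | .left, h => h - 1
  | .stay, h => h
  | .right, h => h + 1

/-- (The program of) an `n`-symbol infinite time Turing machine: the structure of a finite Turing
machine with three tapes (input, working, output), whose head reads and writes the three
cells at its position at once, and with a distinguished limit state. -/
structure Machine (n : ℕ) : Type 1 where
  /-- the states -/
  State : Type
  finite : Finite State
  start : State
  limit : State
  halt : State
  /-- from the state and the three symbols read: the new state, the three symbols to write and the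
  move of the head -/
  trans : State → (Fin 3 → Fin n) → State × (Fin 3 → Fin n) × Move

/-- The cell of index `i` on the tape `t` is the cell `3 * i + t` of the single word of length `ω`
that represents the three tapes. -/
def cell (t : Fin 3) (i : ℕ) : ℕ := 3 * i + t

/-- A snapshot, with set of states `Q`: state, head position, content of the three tapes (coded in
a single word by `cell`). -/
@[ext]
structure Snapshot (n : ℕ) (Q : Type) : Type where
  state : Q
  head : ℕ
  tape : ℕ → Fin n

namespace Machine

variable {n : ℕ}

/-- The initial snapshot on the input `y`: start state, head on the first cell, `y` on the input
tape `0`, and blank symbols `0` on the two other tapes. -/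
def init [NeZero n] (M : Machine n) (y : ℕ → Fin n) : Snapshot n M.State where
  state := M.start
  head := 0
  tape c := if c % 3 = 0 then y (c / 3) else 0

open Classical in
/-- One step of computation; nothing changes once the machine is in its halting state. -/
noncomputable def step (M : Machine n) (s : Snapshot n M.State) : Snapshot n M.State :=
  if s.state = M.halt then s
  else
    let r := M.trans s.state fun t => s.tape (cell t s.head)
    { state := r.1
      head := r.2.2.apply s.head
      tape := fun c => if c / 3 = s.head then r.2.1 (Fin.ofNat 3 c) else s.tape c }

open Classical in
/-- The snapshot at stage `α` of the computation of `M`, as a `Γ`-machine, on the input `y`. At a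
limit stage the head is on the first cell, the state is the limit state, and the tapes are given
by `Γ` applied to the history of the tapes. By convention, a machine that has halted keeps its
halting snapshot at all later stages, limit stages included. -/
noncomputable def run [NeZero n] (M : Machine n) (Γ : LimitOperator.{u} n) (y : ℕ → Fin n)
    (α : Ordinal.{u}) : Snapshot n M.State :=
  Ordinal.limitRecOn (motive := fun _ => Snapshot n M.State) α
    (M.init y)
    (fun _ s => M.step s)
    (fun μ _ prev =>
      if h : ∃ (β : Ordinal.{u}) (hβ : β < μ), (prev β hβ).state = M.halt then
        prev h.choose h.choose_spec.choose
      else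
        { state := M.limit
          head := 0
          tape := Γ ⟨μ, fun β hβ => (prev β hβ).tape⟩ })

end Machine

/-! ### Emulation -/

/-- A snapshot `s` with `k` symbols and a snapshot `s'` with `n ≥ k` symbols match: same state (via
the inclusion `ι` of the states), same head position, same tapes. -/
def Snapshot.Matches {k n : ℕ} {Q Q' : Type} (h : k ≤ n) (ι : Q → Q') (s : Snapshot k Q)
    (s' : Snapshot n Q') : Prop :=
  s'.state = ι s.state ∧ s'.head = s.head ∧ ∀ c, s'.tape c = Fin.castLE h (s.tape c)

/-- The `n`-symbol operator `Γn` emulates the `k`-symbol operator `Γk`: for each `Γk`-machine `M`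
there is a `Γn`-machine `N`, whose states include those of `M`, such that on every input

* the snapshots of `M` and `N` match at every limit stage;
* between a stage `μ` that is `0` or limit and the next limit stage, the snapshots of `M` appear in
  `N` in the same order (the `j`-th one as the `φ j`-th one), hence separated by finitely many
  snapshots;
* all the other snapshots of `N` have a symbol `s ∉ k` in one of their cells. -/
def Emulates {k n : ℕ} [NeZero k] [NeZero n] (h : k ≤ n) (Γn : LimitOperator.{u} n)
    (Γk : LimitOperator.{u} k) : Prop :=
  ∀ M : Machine k, ∃ (N : Machine n) (ι : M.State → N.State),
    Function.Injective ι ∧ ι M.start = N.start ∧ ι M.limit = N.limit ∧ ι M.halt = N.halt ∧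
    ∀ y : ℕ → Fin k,
      (∀ μ : Ordinal.{u}, Order.IsSuccLimit μ →
        (M.run Γk y μ).Matches h ι (N.run Γn (fun i => Fin.castLE h (y i)) μ)) ∧
      ∀ μ : Ordinal.{u}, μ = 0 ∨ Order.IsSuccLimit μ →
        ∃ φ : ℕ → ℕ, StrictMono φ ∧ φ 0 = 0 ∧
          (∀ j : ℕ, (M.run Γk y (μ + j)).Matches h ι
            (N.run Γn (fun i => Fin.castLE h (y i)) (μ + φ j))) ∧
          ∀ i : ℕ, i ∉ Set.range φ →
            ∃ c : ℕ, k ≤ ((N.run Γn (fun i => Fin.castLE h (y i)) (μ + i)).tape c : ℕ)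

end InfTM

namespace InfTM
namespace OrdWord
variable {A B : Type}

/-! Consider a cell that changes only along a fixed cycle through all `n` symbols and never
stabilizes. The hypotheses determine its limit. Contraction forgets how long each symbol stays, and
asymptoticity lets the history start at any chosen symbol of the cycle. What remains can be taken to
be one turn of the cycle, with each symbol repeated `ω` times, raised to a limit power; one turn is
itself a limit word, so looping stability makes the power irrelevant. Hence all these histories
share one limit symbol `s`, provided that the cell restarts at `s` at each earlier limit where it
has not stabilized. This proviso is consistent because `s` does not depend on the symbol at which
the cycle is entered (`IsWalk.eq_cyclic`, `exists_cycle_value`).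

Rename the symbols so that `s` becomes `1` and the cycle becomes `1, 0, 2, …, n - 1`. On cells that
follow this cycle, the operator now behaves as `sup`: the stable value if there is one, and `1`
otherwise (`IsCycleSup`). The machine `sim` makes all cells follow the cycle: a fall from `1` to `0`
is already one step of it, and a rise from `0` to `1` is slowed down through `2, …, n - 1`. These
extra symbols also mark the inserted snapshots. Induction on the limit stages (`simRun_eq`) gives
the emulation: a cell stabilizes in one run if and only if it does in the other, so the limits
agree, and they also restart the cycle at the required symbol. -/

theorem ext_get {w w' : OrdWord.{u} A} (hlen : w.len = w'.len)
    (h : ∀ i hi hi', w.get i hi = w'.get i hi') : w = w' := by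
  obtain ⟨l, f⟩ := w
  obtain ⟨l', f'⟩ := w'
  obtain rfl : l = l' := hlen
  congr 1
  funext i hi
  exact h i hi hi

theorem get_congr (w : OrdWord.{u} A) {i j : Ordinal.{u}} (h : i = j) (hi : i < w.len)
    (hj : j < w.len) : w.get i hi = w.get j hj := by
  subst h; rfl

/-! ### Block starts and contractions. -/

/-- All the letters of `w` at the positions of `[κ, i)` are equal to `x`. -/
def ConstOn (w : OrdWord.{u} A) (κ i : Ordinal.{u}) (x : A) : Prop :=
  ∀ (ξ : Ordinal.{u}) (hξ : ξ < w.len), κ ≤ ξ → ξ < i → w.get ξ hξ = x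

theorem ConstOn.mono {w : OrdWord.{u} A} {κ κ' i : Ordinal.{u}} {x : A} (h : w.ConstOn κ i x)
    (hκ : κ ≤ κ') : w.ConstOn κ' i x :=
  fun ξ hξ h1 h2 => h ξ hξ (hκ.trans h1) h2

theorem ConstOn.unique {w : OrdWord.{u} A} {κ κ' i : Ordinal.{u}} {x x' : A}
    (h : w.ConstOn κ i x) (h' : w.ConstOn κ' i x') (hκ : κ < i) (hκ' : κ' < i)
    (hi : i ≤ w.len) : x = x' := by
  have hm : max κ κ' < i := max_lt hκ hκ'
  rw [← h _ (hm.trans_le hi) (le_max_left _ _) hm, ← h' _ (hm.trans_le hi) (le_max_right _ _) hm]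

theorem not_isBlockStart_iff {w : OrdWord.{u} A} {i : Ordinal.{u}} (hi : i < w.len) :
    ¬ w.IsBlockStart i hi ↔ ∃ κ < i, w.ConstOn κ i (w.get i hi) := by
  unfold IsBlockStart ConstOn
  push Not
  constructor
  · rintro ⟨κ, hκ, h⟩
    exact ⟨κ, hκ, fun ξ _ h1 h2 => h ξ h2 h1⟩
  · rintro ⟨κ, hκ, h⟩
    exact ⟨κ, hκ, fun ξ h1 h2 => h ξ _ h2 h1⟩

theorem blockSet_not_bddAbove (w : OrdWord.{u} A) :
    ¬ BddAbove {i | ∀ hi : i < w.len, w.IsBlockStart i hi} := by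
  rintro ⟨b, hb⟩
  have hm : Order.succ (max b w.len) ∈ {i | ∀ hi : i < w.len, w.IsBlockStart i hi} := fun hi =>
    absurd hi (not_lt.2 ((le_max_right _ _).trans (Order.le_succ _)))
  exact absurd (hb hm) (not_le.2 ((le_max_left _ _).trans_lt (Order.lt_succ _)))

theorem blockSeq_strictMono (w : OrdWord.{u} A) : StrictMono w.blockSeq :=
  Ordinal.enumOrd_strictMono w.blockSet_not_bddAbove

theorem isBlockStart_blockSeq (w : OrdWord.{u} A) (μ : Ordinal.{u}) (h : w.blockSeq μ < w.len) :
    w.IsBlockStart (w.blockSeq μ) h :=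
  Ordinal.enumOrd_mem w.blockSet_not_bddAbove μ h

theorem IsBlockStart.exists_blockSeq {w : OrdWord.{u} A} {i : Ordinal.{u}} {hi : i < w.len}
    (h : w.IsBlockStart i hi) : ∃ μ, w.blockSeq μ = i :=
  Ordinal.enumOrd_surjective w.blockSet_not_bddAbove fun _ => h

theorem blockSeq_le_of_forall_lt {w : OrdWord.{u} A} {i μ : Ordinal.{u}} {hi : i < w.len}
    (h : w.IsBlockStart i hi) (H : ∀ ν < μ, w.blockSeq ν < i) : w.blockSeq μ ≤ i :=
  Ordinal.enumOrd_le_of_forall_lt (fun _ => h) H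

theorem blockSeq_zero (w : OrdWord.{u} A) : w.blockSeq 0 = 0 := by
  unfold blockSeq
  rw [Ordinal.enumOrd_zero]
  refine le_antisymm (csInf_le' ?_) zero_le
  intro hi κ hκ
  exact absurd hκ (not_lt.2 zero_le)

theorem lt_ctr_len_iff {w : OrdWord.{u} A} {μ : Ordinal.{u}} :
    μ < w.ctr.len ↔ w.blockSeq μ < w.len := by
  constructor
  · intro h
    exact lt_of_not_ge fun h' => notMem_of_lt_csInf' h h'
  · intro h
    by_contra h'
    have hne : {μ | w.len ≤ w.blockSeq μ}.Nonempty :=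
      ⟨w.len, Ordinal.le_enumOrd_self w.blockSet_not_bddAbove⟩
    have hmem : w.len ≤ w.blockSeq w.ctr.len := csInf_mem hne
    exact absurd (hmem.trans (w.blockSeq_strictMono.monotone (not_lt.1 h'))) (not_le.2 h)

theorem ctr_get (w : OrdWord.{u} A) (μ : Ordinal.{u}) (hμ : μ < w.ctr.len) :
    w.ctr.get μ hμ = w.get (w.blockSeq μ) (lt_ctr_len_iff.1 hμ) := rfl

/-- Between two consecutive block starts, a word is constant. -/
theorem constOn_blockSeq (w : OrdWord.{u} A) (μ : Ordinal.{u}) (hμ : w.blockSeq μ < w.len) :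
    w.ConstOn (w.blockSeq μ) (w.blockSeq (μ + 1)) (w.get _ hμ) := by
  intro ξ
  induction ξ using WellFoundedLT.induction with
  | ind ξ ih =>
    intro hξ h1 h2
    rcases h1.eq_or_lt with rfl | h1'
    · rfl
    have hb : ¬ w.IsBlockStart ξ hξ := by
      intro hb
      obtain ⟨ν, rfl⟩ := hb.exists_blockSeq
      rw [w.blockSeq_strictMono.lt_iff_lt] at h1' h2
      exact absurd (Order.lt_add_one_iff.1 h2) (not_le.2 h1')
    obtain ⟨κ, hκ, hc⟩ := (not_isBlockStart_iff hξ).1 hb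
    -- The letter at `ξ` already occurs at an earlier position that is still in the interval, so the
    -- induction applies there.
    have hm : max κ (w.blockSeq μ) < ξ := max_lt hκ h1'
    rw [← hc _ (hm.trans hξ) (le_max_left _ _) hm]
    exact ih _ hm (hm.trans hξ) (le_max_right _ _) (hm.trans h2)

/-- The contraction of a word from an enumeration of its block starts. -/
theorem ctr_eq_of_enumeration (w v : OrdWord.{u} A) (f : Ordinal.{u} → Ordinal.{u})
    (hf : StrictMono f) (hlt : ∀ μ < v.len, f μ < w.len)
    (hb : ∀ i (hi : i < w.len), w.IsBlockStart i hi ↔ ∃ μ < v.len, f μ = i)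
    (hv : ∀ μ (hμ : μ < v.len), v.get μ hμ = w.get (f μ) (hlt μ hμ)) : w.ctr = v := by
  have key : ∀ μ < v.len, w.blockSeq μ = f μ := by
    intro μ
    induction μ using WellFoundedLT.induction with
    | ind μ ih =>
      intro hμ
      have hle : w.blockSeq μ ≤ f μ := by
        refine blockSeq_le_of_forall_lt ((hb _ (hlt μ hμ)).2 ⟨μ, hμ, rfl⟩) fun ν hν => ?_
        rw [ih ν hν (hν.trans hμ)]
        exact hf hν
      refine hle.antisymm (le_of_not_gt fun hgt => ?_)
      have hlen : w.blockSeq μ < w.len := hgt.trans (hlt μ hμ)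
      obtain ⟨ν, hν, hνe⟩ := (hb _ hlen).1 (w.isBlockStart_blockSeq μ hlen)
      have hνμ : ν < μ := hf.lt_iff_lt.1 (hνe ▸ hgt)
      rw [← ih ν hνμ hν] at hνe
      exact hνμ.ne (w.blockSeq_strictMono.injective hνe)
  have hiff : ∀ μ, μ < w.ctr.len ↔ μ < v.len := by
    intro μ
    rw [lt_ctr_len_iff]
    refine ⟨fun h => ?_, fun h => key μ h ▸ hlt μ h⟩
    obtain ⟨ν, hν, hνe⟩ := (hb _ h).1 (w.isBlockStart_blockSeq μ h)
    rw [← key ν hν] at hνe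
    exact w.blockSeq_strictMono.injective hνe ▸ hν
  refine ext_get (le_antisymm (le_of_not_gt fun h => lt_irrefl _ ((hiff _).1 h))
    (le_of_not_gt fun h => lt_irrefl _ ((hiff _).2 h))) fun μ h h' => ?_
  rw [hv, ctr_get]
  exact w.get_congr (key μ h') _ _

/-! ### Walks along a cycle of letters, and their contractions. -/

/-- At each position `i > 0`, either `w` is eventually constant below `i` and its letter at `i` is
the same or the `next` one, or `w` is not eventually constant below `i` and its letter at `i` is
`base`. -/
def IsWalk (next : A → A) (base : A) (w : OrdWord.{u} A) : Prop :=
  ∀ (i : Ordinal.{u}) (hi : i < w.len), 0 < i →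
    (∃ κ < i, ∃ x, w.ConstOn κ i x ∧ (w.get i hi = x ∨ w.get i hi = next x)) ∨
      ((∀ κ < i, ∀ x, ¬ w.ConstOn κ i x) ∧ w.get i hi = base)

/-- Just below a successor block start the word is constant, so the walk either stays or moves to
the next letter; staying is impossible at a block start. -/
theorem IsWalk.ctr_get_succ {next : A → A} {base : A} {w : OrdWord.{u} A}
    (h : w.IsWalk next base) (μ : Ordinal.{u}) (hμ : μ < w.ctr.len) (hμ' : μ + 1 < w.ctr.len) :
    w.ctr.get (μ + 1) hμ' = next (w.ctr.get μ hμ) := by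
  rw [ctr_get, ctr_get]
  have h1 := lt_ctr_len_iff.1 hμ
  have h2 := lt_ctr_len_iff.1 hμ'
  have hlt : w.blockSeq μ < w.blockSeq (μ + 1) := w.blockSeq_strictMono (lt_add_one μ)
  have hc := w.constOn_blockSeq μ h1
  rcases h _ h2 (zero_le.trans_lt hlt) with ⟨κ, hκ, x, hx, hor⟩ | ⟨hnot, _⟩
  · obtain rfl := hx.unique hc hκ hlt h2.le
    rcases hor with h3 | h3
    · rw [← h3] at hc
      exact absurd (w.isBlockStart_blockSeq _ h2) ((not_isBlockStart_iff h2).2 ⟨_, hlt, hc⟩)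
    · exact h3
  · exact absurd hc (hnot _ hlt _)

/-- If a word is constant on `[κ, i)`, there is a last block start below `i`. -/
theorem ConstOn.exists_blockSeq_lt {w : OrdWord.{u} A} {κ i : Ordinal.{u}} {x : A}
    (hc : w.ConstOn κ i x) (hκ : κ < i) (hi : i ≤ w.len) :
    ∃ ν, w.blockSeq ν < i ∧ i ≤ w.blockSeq (ν + 1) := by
  have hne : {β | w.ConstOn β i x}.Nonempty := ⟨κ, hc⟩
  -- The least start of the constant stretch is a block start, since otherwise the stretch would
  -- extend further to the left. No block start lies strictly between it and `i`.
  set β := sInf {β | w.ConstOn β i x} with hβ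
  have hβc : w.ConstOn β i x := csInf_mem hne
  have hβi : β < i := (csInf_le' hc).trans_lt hκ
  have hβs : w.IsBlockStart β (hβi.trans_le hi) := by
    by_contra hb
    obtain ⟨κ', hκ', hc'⟩ := (not_isBlockStart_iff _).1 hb
    refine notMem_of_lt_csInf' (hβ ▸ hκ') fun ξ hξ h1 h2 => ?_
    rcases lt_or_ge ξ β with h3 | h3
    · rw [hc' ξ hξ h1 h3]
      exact hβc β _ le_rfl hβi
    · exact hβc ξ hξ h3 h2
  obtain ⟨ν, hν⟩ := hβs.exists_blockSeq
  refine ⟨ν, hν ▸ hβi, le_of_not_gt fun hlt => ?_⟩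
  have hlen := hlt.trans_le hi
  refine (not_isBlockStart_iff hlen).2 ⟨β, ?_, fun ξ hξ h1 h2 => ?_⟩
    (w.isBlockStart_blockSeq _ hlen)
  · rw [← hν]
    exact w.blockSeq_strictMono (lt_add_one ν)
  · rw [hβc ξ hξ h1 (h2.trans hlt), hβc _ hlen (h1.trans h2.le) hlt]

/-- Below a block start of limit index the block starts have no last element, so the word is not
eventually constant there and the walk must restart. -/
theorem IsWalk.ctr_get_limit {next : A → A} {base : A} {w : OrdWord.{u} A}
    (h : w.IsWalk next base) (μ : Ordinal.{u}) (hlim : Order.IsSuccLimit μ)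
    (hμ : μ < w.ctr.len) : w.ctr.get μ hμ = base := by
  rw [ctr_get]
  have h1 := lt_ctr_len_iff.1 hμ
  have hpos : 0 < w.blockSeq μ := by
    rw [← w.blockSeq_zero]
    exact w.blockSeq_strictMono hlim.bot_lt
  rcases h _ h1 hpos with ⟨κ, hκ, x, hx, _⟩ | ⟨_, h2⟩
  · obtain ⟨ν, h2, h3⟩ := hx.exists_blockSeq_lt hκ h1.le
    rw [w.blockSeq_strictMono.lt_iff_lt] at h2
    rw [w.blockSeq_strictMono.le_iff_le] at h3
    exact absurd h3 (not_le.2 (hlim.add_one_lt h2))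
  · exact h2

/-- A last block would be a constant tail. -/
theorem ctr_isLimit {w : OrdWord.{u} A} (hw : 0 < w.len)
    (h : ∀ κ < w.len, ∀ x, ¬ w.ConstOn κ w.len x) : w.ctr.IsLimit := by
  unfold IsLimit
  rcases Ordinal.zero_or_succ_or_isSuccLimit w.ctr.len with h0 | ⟨ν, hν⟩ | hl
  · have : (0 : Ordinal) < w.ctr.len := lt_ctr_len_iff.2 (by rwa [blockSeq_zero])
    exact absurd h0 this.ne'
  · have h1 : w.blockSeq ν < w.len := lt_ctr_len_iff.1 (hν ▸ Order.lt_succ ν)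
    have h2 : w.len ≤ w.blockSeq (ν + 1) := by
      refine le_of_not_gt fun h2 => ?_
      rw [← lt_ctr_len_iff, ← hν] at h2
      exact absurd h2 (lt_irrefl _)
    exact absurd (fun ξ hξ h3 h4 => w.constOn_blockSeq ν h1 ξ hξ h3 (h4.trans_le h2)) (h _ h1 _)
  · exact hl

/-! ### Cyclic words -/

/-- The finite part of an ordinal. -/
noncomputable def finPart (ν : Ordinal.{u}) : ℕ :=
  (Ordinal.lt_omega0.1 (Ordinal.mod_lt ν Ordinal.omega0_ne_zero)).choose

theorem natCast_finPart (ν : Ordinal.{u}) : (finPart ν : Ordinal.{u}) = ν % Ordinal.omega0 :=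
  (Ordinal.lt_omega0.1 (Ordinal.mod_lt ν Ordinal.omega0_ne_zero)).choose_spec.symm

theorem finPart_add_natCast (q : Ordinal.{u}) (k : ℕ) :
    finPart (Ordinal.omega0 * q + k) = k := by
  have h := natCast_finPart (Ordinal.omega0 * q + k)
  rw [Ordinal.mul_add_mod_self, Ordinal.natCast_mod_omega0] at h
  exact_mod_cast h

theorem eq_omega0_mul_add_finPart (ν : Ordinal.{u}) :
    ν = Ordinal.omega0 * (ν / Ordinal.omega0) + finPart ν := by
  rw [natCast_finPart, Ordinal.div_add_mod]

theorem finPart_add_one (ν : Ordinal.{u}) : finPart (ν + 1) = finPart ν + 1 := by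
  conv_lhs => rw [eq_omega0_mul_add_finPart ν, add_assoc]
  exact_mod_cast finPart_add_natCast _ (finPart ν + 1)

theorem finPart_natCast (k : ℕ) : finPart (k : Ordinal.{u}) = k := by
  simpa using finPart_add_natCast (0 : Ordinal.{u}) k

theorem finPart_limit {ν : Ordinal.{u}} (h : Order.IsSuccLimit ν) : finPart ν = 0 := by
  by_contra h0
  obtain ⟨k, hk⟩ := Nat.exists_eq_succ_of_ne_zero h0
  have h1 := eq_omega0_mul_add_finPart ν
  rw [hk, Nat.succ_eq_add_one, Nat.cast_add, Nat.cast_one, ← add_assoc] at h1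
  have hlt := lt_add_one (Ordinal.omega0 * (ν / Ordinal.omega0) + (k : Ordinal))
  rw [← h1] at hlt
  exact absurd h1 (h.add_one_lt hlt).ne'

/-- The word of length `ω * α` where each letter of the cycle `a, next a, next (next a), …` is
repeated `ω` times, and where the cycle starts again at limits. -/
noncomputable def cyclic (next : A → A) (a : A) (α : Ordinal.{u}) : OrdWord.{u} A where
  len := Ordinal.omega0 * α
  get i _ := next^[finPart (i / Ordinal.omega0)] a

theorem cyclic_isLimit (next : A → A) (a : A) {α : Ordinal.{u}} (hα : 0 < α) :
    (cyclic next a α).IsLimit :=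
  Ordinal.isSuccLimit_mul_left Ordinal.isSuccLimit_omega0 hα

theorem natCast_mul_limit {n : ℕ} (hn : 0 < n) {α : Ordinal.{u}} (hα : Order.IsSuccLimit α) :
    (n : Ordinal.{u}) * α = α := by
  have h := eq_omega0_mul_add_finPart α
  rw [finPart_limit hα, Nat.cast_zero, add_zero] at h
  rw [h, ← mul_assoc, Ordinal.natCast_mul_omega0 hn]

theorem iterate_finPart_natCast_mul_add {next : A → A} {n : ℕ} (hn : 0 < n) (a : A)
    (hcyc : next^[n] a = a) (δ : Ordinal.{u}) (k : ℕ) :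
    next^[finPart (n * δ + k)] a = next^[k] a := by
  have h : (n : Ordinal.{u}) * δ + k
      = Ordinal.omega0 * (δ / Ordinal.omega0) + ((n * finPart δ + k : ℕ) : Ordinal.{u}) := by
    conv_lhs => rw [eq_omega0_mul_add_finPart δ]
    rw [mul_add, ← mul_assoc, Ordinal.natCast_mul_omega0 hn]
    push_cast
    rw [add_assoc]
  rw [h, finPart_add_natCast, add_comm, Function.iterate_add_apply, Function.iterate_mul,
    Function.iterate_fixed hcyc]

/-- This brings looping stability into play. Full turns of the cycle do not change the letter, and
`n * α = α` for a limit `α`, so repeating one turn also restarts correctly at limits. -/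
theorem rep_cyclic {next : A → A} {n : ℕ} (hn : 0 < n) {a : A} (hcyc : next^[n] a = a)
    {α : Ordinal.{u}} (hα : Order.IsSuccLimit α) :
    (cyclic next a (n : Ordinal.{u})).rep α = cyclic next a α := by
  refine ext_get ?_ fun i hi hi' => ?_
  · change Ordinal.omega0 * n * α = Ordinal.omega0 * α
    rw [mul_assoc, natCast_mul_limit hn hα]
  · change next^[finPart (i % (Ordinal.omega0 * n) / Ordinal.omega0)] a
      = next^[finPart (i / Ordinal.omega0)] a
    have hn0 : (Ordinal.omega0 * n : Ordinal.{u}) ≠ 0 :=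
      mul_ne_zero Ordinal.omega0_ne_zero (by exact_mod_cast hn.ne')
    set ρ := i % (Ordinal.omega0 * n) with hρ
    set δ := i / (Ordinal.omega0 * n) with hδ
    have h1 : i / Ordinal.omega0 = n * δ + ρ / Ordinal.omega0 := by
      conv_lhs => rw [← Ordinal.div_add_mod i (Ordinal.omega0 * n), mul_assoc,
        Ordinal.mul_add_div _ Ordinal.omega0_ne_zero]
    have h2 : ρ / Ordinal.omega0 < n := by
      rw [← Ordinal.lt_mul_iff_div_lt Ordinal.omega0_ne_zero]
      exact Ordinal.mod_lt i hn0
    obtain ⟨k, hk⟩ := Ordinal.lt_omega0.1 (h2.trans (Ordinal.natCast_lt_omega0 n))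
    rw [h1, hk, iterate_finPart_natCast_mul_add hn a hcyc, finPart_natCast]

/-- Each letter fills a block of length `ω`, so the block starts are the multiples `ω * μ`. The
repetition of the letters serves only to make one turn a limit word and disappears under
contraction. -/
theorem ctr_cyclic {next : A → A} (hne : ∀ x, next x ≠ x) (a : A) (α : Ordinal.{u}) :
    (cyclic next a α).ctr = ⟨α, fun μ _ => next^[finPart μ] a⟩ := by
  have h0 := Ordinal.omega0_ne_zero
  have hlet : ∀ ν, next^[finPart (ν + 1)] a ≠ next^[finPart ν] a := by
    intro ν
    rw [finPart_add_one, Function.iterate_succ_apply']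
    exact hne _
  have hf : StrictMono fun μ : Ordinal.{u} => Ordinal.omega0 * μ := fun x y h =>
    mul_lt_mul_of_pos_left h Ordinal.omega0_pos
  refine ctr_eq_of_enumeration _ _ (fun μ => Ordinal.omega0 * μ) hf (fun μ hμ => hf hμ) ?_ ?_
  · intro i hi
    change i < Ordinal.omega0 * α at hi
    constructor
    · intro hb
      refine ⟨i / Ordinal.omega0, (Ordinal.lt_mul_iff_div_lt h0).1 hi, ?_⟩
      by_contra hne'
      have hm : i % Ordinal.omega0 ≠ 0 := by
        intro hm
        have := Ordinal.div_add_mod i Ordinal.omega0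
        rw [hm, add_zero] at this
        exact hne' this
      have hlt : Ordinal.omega0 * (i / Ordinal.omega0) < i :=
        lt_of_le_of_ne (Ordinal.mul_div_le _ _) hne'
      obtain ⟨ξ, hξ, h1, h2⟩ := hb _ hlt
      apply h2
      change next^[finPart (ξ / Ordinal.omega0)] a = next^[finPart (i / Ordinal.omega0)] a
      congr 2
      refine le_antisymm (Ordinal.div_le_left hξ.le _) ?_
      rwa [← Ordinal.mul_le_iff_le_div h0]
    · rintro ⟨μ, hμ, rfl⟩ κ hκ
      change κ < Ordinal.omega0 * μ at hκ
      change ∃ (ξ : Ordinal) (_ : ξ < Ordinal.omega0 * μ), κ ≤ ξ ∧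
        next^[finPart (ξ / Ordinal.omega0)] a
          ≠ next^[finPart (Ordinal.omega0 * μ / Ordinal.omega0)] a
      rw [Ordinal.mul_div_cancel _ h0]
      rcases Ordinal.zero_or_succ_or_isSuccLimit μ with rfl | ⟨ν, rfl⟩ | hl
      · simp at hκ
      · rw [Order.succ_eq_add_one] at *
        have hlt : Ordinal.omega0 * ν < Ordinal.omega0 * (ν + 1) := hf (lt_add_one ν)
        refine ⟨max κ (Ordinal.omega0 * ν), max_lt hκ hlt, le_max_left _ _, ?_⟩
        have : max κ (Ordinal.omega0 * ν) / Ordinal.omega0 = ν := by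
          refine le_antisymm ?_ ?_
          · rw [← Order.lt_add_one_iff, ← Ordinal.lt_mul_iff_div_lt h0]
            exact max_lt hκ hlt
          · rw [← Ordinal.mul_le_iff_le_div h0]
            exact le_max_right _ _
        rw [this]
        exact (hlet ν).symm
      · set ν := κ / Ordinal.omega0 with hν
        have hνμ : ν < μ := (Ordinal.lt_mul_iff_div_lt h0).1 hκ
        have hκν : κ < Ordinal.omega0 * (ν + 1) := by
          rw [Ordinal.lt_mul_iff_div_lt h0]
          exact lt_add_one _
        have h1 : ν + 1 < μ := hl.add_one_lt hνμ
        have h2 : ν + 1 + 1 < μ := hl.add_one_lt h1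
        -- The letters of indices `ν + 1` and `ν + 2` differ, so at least one of them differs from
        -- the letter of index `μ`.
        by_cases h3 : next^[finPart (ν + 1)] a = next^[finPart μ] a
        · refine ⟨Ordinal.omega0 * (ν + 1 + 1), hf h2,
            hκν.le.trans (hf (lt_add_one _)).le, ?_⟩
          rw [Ordinal.mul_div_cancel _ h0, ← h3]
          exact hlet _
        · refine ⟨Ordinal.omega0 * (ν + 1), hf h1, hκν.le, ?_⟩
          rwa [Ordinal.mul_div_cancel _ h0]
  · intro μ hμ
    change next^[finPart μ] a = next^[finPart (Ordinal.omega0 * μ / Ordinal.omega0)] a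
    rw [Ordinal.mul_div_cancel _ h0]

/-- The contraction of a walk which starts with `base` and is not eventually constant. -/
theorem IsWalk.ctr_eq {next : A → A} {base : A} {w : OrdWord.{u} A} (h : w.IsWalk next base)
    (hw : 0 < w.len) (hbase : w.get 0 hw = base) :
    w.ctr = ⟨w.ctr.len, fun μ _ => next^[finPart μ] base⟩ := by
  refine ext_get rfl fun μ => ?_
  change ∀ hi, μ < w.ctr.len → w.ctr.get μ hi = next^[finPart μ] base
  induction μ using Ordinal.limitRecOn with
  | zero =>
    intro h0 _
    have : finPart (0 : Ordinal.{u}) = 0 := by simpa using finPart_natCast.{u} 0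
    rw [this, ctr_get, Function.iterate_zero_apply, ← hbase]
    exact w.get_congr w.blockSeq_zero _ _
  | add_one μ ih =>
    intro hi _
    have hi' := (lt_add_one μ).trans hi
    rw [h.ctr_get_succ μ hi' hi, ih hi' hi', finPart_add_one, Function.iterate_succ_apply']
  | limit μ hl _ =>
    intro hi _
    rw [h.ctr_get_limit μ hl, finPart_limit hl, Function.iterate_zero_apply]

/-! ### Final segments -/

/-- The final segment of `w` which starts at the position `α`. -/
noncomputable def drop (w : OrdWord.{u} A) (α : Ordinal.{u}) : OrdWord.{u} A where
  len := w.len - α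
  get i hi := w.get (α + i) (Ordinal.lt_sub.1 hi)

theorem drop_isFinalSegment (w : OrdWord.{u} A) {α : Ordinal.{u}} (hα : α ≤ w.len) :
    (w.drop α).IsFinalSegment w :=
  ⟨α, Ordinal.add_sub_cancel_of_le hα, fun _ _ _ => rfl⟩

theorem drop_len_pos (w : OrdWord.{u} A) {α : Ordinal.{u}} (hα : α < w.len) :
    0 < (w.drop α).len := by
  change 0 < w.len - α
  rw [Ordinal.lt_sub, add_zero]
  exact hα

theorem constOn_drop_iff {w : OrdWord.{u} A} {α κ i : Ordinal.{u}} {x : A} :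
    (w.drop α).ConstOn κ i x ↔ w.ConstOn (α + κ) (α + i) x := by
  constructor
  · intro h ξ hξ h1 h2
    have h3 : α ≤ ξ := le_self_add.trans h1
    obtain ⟨ζ, rfl⟩ := exists_add_of_le h3
    rw [add_le_add_iff_left] at h1
    rw [add_lt_add_iff_left] at h2
    exact h ζ (Ordinal.lt_sub.2 hξ) h1 h2
  · intro h ξ hξ h1 h2
    exact h _ _ (add_le_add_right h1 _) (add_lt_add_right h2 _)

theorem IsWalk.drop {next : A → A} {base : A} {w : OrdWord.{u} A} (h : w.IsWalk next base)
    (α : Ordinal.{u}) : (w.drop α).IsWalk next base := by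
  intro i hi hpos
  have hαi : α < α + i := by
    conv_lhs => rw [← add_zero α]
    exact add_lt_add_right hpos α
  rcases h (α + i) (Ordinal.lt_sub.1 hi) (zero_le.trans_lt hαi) with
    ⟨κ, hκ, x, hx, hor⟩ | ⟨hnot, hb⟩
  · left
    refine ⟨κ - α, Ordinal.sub_lt_of_lt_add hκ hpos, x, constOn_drop_iff.2 (hx.mono ?_), hor⟩
    exact Ordinal.le_add_sub _ _
  · right
    exact ⟨fun κ hκ x hx => hnot _ (add_lt_add_right hκ α) x (constOn_drop_iff.1 hx), hb⟩

theorem not_constOn_drop {w : OrdWord.{u} A} (h : ∀ κ < w.len, ∀ x, ¬ w.ConstOn κ w.len x)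
    {α : Ordinal.{u}} (hα : α < w.len) :
    ∀ κ < (w.drop α).len, ∀ x, ¬ (w.drop α).ConstOn κ (w.drop α).len x := by
  intro κ hκ x hx
  rw [constOn_drop_iff] at hx
  change w.ConstOn (α + κ) (α + (w.len - α)) x at hx
  rw [Ordinal.add_sub_cancel_of_le hα.le] at hx
  exact h _ (Ordinal.lt_sub.1 hκ) x hx

/-! ### The common limit of the walks that do not stabilize. -/

/-- The walk visits `base`. -/
theorem IsWalk.exists_get_eq_base {next : A → A} {base : A} {w : OrdWord.{u} A}
    (h : w.IsWalk next base) (hreach : ∀ a, ∃ k : ℕ, next^[k] a = base) (hw : 0 < w.len)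
    (hnot : ∀ κ < w.len, ∀ x, ¬ w.ConstOn κ w.len x) :
    ∃ (i : Ordinal.{u}) (hi : i < w.len), w.get i hi = base := by
  have hl : Order.IsSuccLimit w.ctr.len := ctr_isLimit hw hnot
  -- The contraction has limit length, hence at least `ω` letters, and the first `ω` of them run
  -- through the whole cycle.
  have hk : ∀ (k : ℕ) (hi : (k : Ordinal.{u}) < w.ctr.len),
      w.ctr.get k hi = next^[k] (w.ctr.get 0 hl.bot_lt) := by
    intro k
    induction k with
    | zero => intro hi; exact w.ctr.get_congr (by simp) _ _
    | succ k ih =>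
      intro hi
      have h1 : ((k : Ordinal.{u}) + 1) < w.ctr.len := by exact_mod_cast hi
      have h2 : (k : Ordinal.{u}) < w.ctr.len := (lt_add_one _).trans h1
      rw [Function.iterate_succ_apply', ← ih h2, ← h.ctr_get_succ _ h2 h1]
      exact w.ctr.get_congr (by push_cast; rfl) _ _
  obtain ⟨k, hk'⟩ := hreach (w.ctr.get 0 hl.bot_lt)
  have hlt := Ordinal.natCast_lt_of_isSuccLimit hl k
  exact ⟨w.blockSeq k, lt_ctr_len_iff.1 hlt, by rw [← ctr_get w k hlt, hk, hk']⟩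

/-- An asymptotic, contraction-proof and looping stable function has the same value on all the
walks that are not eventually constant. -/
theorem IsWalk.eq_cyclic {R : Type*} {G : OrdWord.{u} A → R}
    (hasym : ∀ H H' : OrdWord.{u} A, H.IsLimit → H'.IsFinalSegment H → 0 < H'.len → G H = G H')
    (hctr : ∀ H H' : OrdWord.{u} A, H.IsLimit → H'.IsLimit → H.ctr = H'.ctr → G H = G H')
    (hloop : ∀ (H : OrdWord.{u} A) (α α' : Ordinal.{u}), H.IsLimit → Order.IsSuccLimit α →
      Order.IsSuccLimit α' → G (H.rep α) = G (H.rep α'))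
    {next : A → A} (hne : ∀ x, next x ≠ x) {n : ℕ} (hn : 0 < n) {base : A}
    (hcyc : next^[n] base = base) {w : OrdWord.{u} A} (h : w.IsWalk next base)
    (hvisit : ∃ (i : Ordinal.{u}) (hi : i < w.len), w.get i hi = base)
    (hlim : w.IsLimit) (hnot : ∀ κ < w.len, ∀ x, ¬ w.ConstOn κ w.len x) :
    G w = G (cyclic next base Ordinal.omega0) := by
  obtain ⟨i, hi, hbase⟩ := hvisit
  have hpos := w.drop_len_pos hi
  have hlim' : Order.IsSuccLimit (w.drop i).len :=
    Ordinal.isSuccLimit_sub hlim.isSuccPrelimit hi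
  have hL := ctr_isLimit hpos (not_constOn_drop hnot hi)
  have hget : (w.drop i).get 0 hpos = base := by
    rw [← hbase]
    exact w.get_congr (add_zero i) _ _
  -- Cut the walk at a visit to `base`, replace it by the cyclic word with the same contraction, and
  -- write both cyclic words as limit powers of the same turn.
  rw [hasym w (w.drop i) hlim (w.drop_isFinalSegment hi.le) hpos,
    hctr (w.drop i) (cyclic next base (w.drop i).ctr.len) hlim'
      (cyclic_isLimit _ _ hL.bot_lt) (by rw [ctr_cyclic hne, ← (h.drop i).ctr_eq hpos hget]),
    ← rep_cyclic hn hcyc hL, ← rep_cyclic hn hcyc Ordinal.isSuccLimit_omega0]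
  exact hloop _ _ _ (cyclic_isLimit _ _ (by exact_mod_cast hn)) hL Ordinal.isSuccLimit_omega0

/-- Since `k + ω = ω`, removing `k` blocks keeps the length and only rotates the cycle. With
asymptoticity, this makes the limit independent of the starting letter. -/
theorem drop_cyclic (next : A → A) (a : A) (k : ℕ) :
    (cyclic.{u} next a Ordinal.omega0).drop (Ordinal.omega0 * k)
      = cyclic next (next^[k] a) Ordinal.omega0 := by
  have hlen : Ordinal.omega0.{u} * Ordinal.omega0 - Ordinal.omega0 * k
      = Ordinal.omega0 * Ordinal.omega0 := by
    conv_lhs => rw [← Ordinal.natCast_add_omega0 k, mul_add]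
    rw [Ordinal.add_sub_cancel, Ordinal.natCast_add_omega0]
  refine ext_get hlen fun i hi hi' => ?_
  change next^[finPart ((Ordinal.omega0 * k + i) / Ordinal.omega0)] a
    = next^[finPart (i / Ordinal.omega0)] (next^[k] a)
  have h1 : i / Ordinal.omega0 < Ordinal.omega0 := (Ordinal.lt_mul_iff_div_lt Ordinal.omega0_ne_zero).1 hi'
  obtain ⟨m, hm⟩ := Ordinal.lt_omega0.1 h1
  rw [Ordinal.mul_add_div _ Ordinal.omega0_ne_zero, hm, ← Nat.cast_add, finPart_natCast,
    finPart_natCast, ← Function.iterate_add_apply, add_comm]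

end OrdWord
end InfTM

/-! ### From tape contents to single cells, and the renaming of the symbols. -/

namespace InfTM
namespace OrdWord
variable {A B : Type}

theorem ConstOn.of_map {f : A → B} (hf : Function.Injective f) {w : OrdWord.{u} A}
    {κ i : Ordinal.{u}} {y : B} (h : (w.map f).ConstOn κ i y) (hκ : κ < i) (hi : i ≤ w.len) :
    w.ConstOn κ i (w.get κ (hκ.trans_le hi)) ∧ y = f (w.get κ (hκ.trans_le hi)) := by
  have hy : f (w.get κ (hκ.trans_le hi)) = y := h κ (hκ.trans_le hi) le_rfl hκ
  exact ⟨fun ξ hξ h1 h2 => hf ((h ξ hξ h1 h2).trans hy.symm), hy.symm⟩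

theorem IsWalk.map {f : A → B} (hf : Function.Injective f) {next : A → A} {next' : B → B}
    (hnext : ∀ a, f (next a) = next' (f a)) {base : A} {w : OrdWord.{u} A}
    (h : w.IsWalk next base) : (w.map f).IsWalk next' (f base) := by
  intro i hi hpos
  rcases h i hi hpos with ⟨κ, hκ, x, hx, hor⟩ | ⟨hnot, hb⟩
  · refine Or.inl ⟨κ, hκ, f x, fun ξ hξ h1 h2 => congrArg f (hx ξ hξ h1 h2), ?_⟩
    rcases hor with h1 | h1
    · exact Or.inl (congrArg f h1)
    · exact Or.inr ((congrArg f h1).trans (hnext x))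
  · exact Or.inr ⟨fun κ hκ y hy => hnot κ hκ _ (hy.of_map hf hκ hi.le).1, congrArg f hb⟩

end OrdWord

open OrdWord

theorem val_iterate_add_one {n : ℕ} [NeZero n] (a : Fin n) (k : ℕ) :
    (((fun x : Fin n => x + 1)^[k] a : Fin n) : ℕ) = (a + k) % n := by
  induction k with
  | zero => simp [Nat.mod_eq_of_lt a.2]
  | succ k ih =>
    rw [Function.iterate_succ_apply', Fin.val_add, ih, Fin.val_one', Nat.add_mod_mod,
      Nat.mod_add_mod, add_assoc]

/-- The cyclic order `1, 0, 2, 3, …, n - 1` on `n ≥ 2` symbols. -/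
def cycNext {n : ℕ} (hn : 2 ≤ n) (x : Fin n) : Fin n :=
  if (x : ℕ) = 1 then ⟨0, by omega⟩
  -- The maximum sends `0` to `2`, as the symbol `1` is skipped between them.
  else if h : max (x : ℕ) 1 + 1 < n then ⟨max (x : ℕ) 1 + 1, h⟩ else ⟨1, by omega⟩

theorem cycNext_swap {n : ℕ} [NeZero n] (hn : 2 ≤ n) (d : Fin n) :
    cycNext hn (Equiv.swap 0 1 d) = Equiv.swap 0 1 (d + 1) := by
  have h1 : ((1 : Fin n) : ℕ) = 1 := by rw [Fin.val_one', Nat.mod_eq_of_lt (by omega)]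
  have h0 : ((0 : Fin n) : ℕ) = 0 := rfl
  have hd : ((d + 1 : Fin n) : ℕ) = if (d : ℕ) + 1 = n then 0 else (d : ℕ) + 1 := by
    rw [Fin.val_add, h1]
    split_ifs with h
    · simp [h]
    · exact Nat.mod_eq_of_lt (by omega)
  have hlt := d.2
  have hswap : ∀ x : Fin n, ((Equiv.swap 0 1 x : Fin n) : ℕ)
      = if (x : ℕ) = 0 then (1 : ℕ) else if (x : ℕ) = 1 then (0 : ℕ) else (x : ℕ) := by
    intro x
    simp only [Equiv.swap_apply_def, Fin.ext_iff, h0, h1]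
    split_ifs
    exacts [h1, h0, rfl]
  have hcyc : ∀ x : Fin n, ((cycNext hn x : Fin n) : ℕ)
      = if (x : ℕ) = 1 then (0 : ℕ)
        else if max (x : ℕ) 1 + 1 < n then max (x : ℕ) 1 + 1 else (1 : ℕ) := by
    intro x
    unfold cycNext
    split_ifs <;> rfl
  refine Fin.ext ?_
  rw [hcyc, hswap, hswap, hd, max_def]
  split_ifs <;> first | omega | contradiction

namespace LimitOperator
variable {n : ℕ} {Γ : LimitOperator.{u} n}

/-- On a final segment the cell has the same history as under a constant tape content, to which
stability applies; the other cells do not matter. -/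
theorem Stable.apply_eventually_const (hs : Γ.Stable) (hc : Γ.CellByCell) (ha : Γ.Asymptotic)
    {H : OrdWord.{u} (ℕ → Fin n)} (hH : H.IsLimit) {c : ℕ} {κ : Ordinal.{u}} (hκ : κ < H.len)
    {x : Fin n} (h : (H.map fun y => y c).ConstOn κ H.len x) : Γ H c = x := by
  obtain ⟨γ, hγ⟩ := hc
  have hlim : Order.IsSuccLimit (H.drop κ).len := Ordinal.isSuccLimit_sub hH.isSuccPrelimit hκ
  rw [ha H (H.drop κ) hH (H.drop_isFinalSegment hκ.le) (H.drop_len_pos hκ), ← hγ _ hlim c]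
  have : (H.drop κ).map (fun y => y c)
      = (OrdWord.const (fun _ => x) (H.drop κ).len).map fun y : ℕ → Fin n => y c := by
    refine ext_get rfl fun i hi _ => ?_
    refine h (κ + i) (Ordinal.lt_sub.1 hi) le_self_add ?_
    exact Ordinal.lt_sub.1 hi
  rw [this]
  exact (hγ (OrdWord.const _ _) hlim c).trans (congrFun (hs _ _ hlim) c)

/-- The limit value of all the cells which walk along the cycle `0, 1, …, n - 1` without
stabilizing. -/
theorem Simulational.exists_cycle_value [NeZero n] (hn : 2 ≤ n) (hΓ : Γ.Simulational)
    (hloop : Γ.LoopingStable) :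
    ∃ s : Fin n, ∀ (H : OrdWord.{u} (ℕ → Fin n)) (c : ℕ), H.IsLimit →
      (H.map fun y => y c).IsWalk (fun x => x + 1) s →
      (∀ κ < H.len, ∀ x, ¬ (H.map fun y => y c).ConstOn κ H.len x) → Γ H c = s := by
  obtain ⟨γ, hγ⟩ := hΓ.cellByCell
  -- The hypotheses on `Γ` concern words of tape contents, so a symbol is represented by the tape
  -- with that symbol in all cells.
  let f : Fin n → ℕ → Fin n := fun a _ => a
  have hf : Function.Injective f := fun a b h => congrFun h 0
  let next : (ℕ → Fin n) → ℕ → Fin n := fun y c => y c + 1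
  have hsemi : ∀ (k : ℕ) (a : Fin n), next^[k] (f a) = f ((fun x => x + 1)^[k] a) := by
    intro k a
    exact ((Function.Semiconj.iterate_right (f := f) (ga := fun x => x + 1) (gb := next)
      (fun _ => rfl) k) a).symm
  have hne : ∀ y, next y ≠ y := by
    intro y h
    have h0 := congrArg Fin.val (congrFun h 0)
    change ((y 0 + 1 : Fin n) : ℕ) = y 0 at h0
    rw [Fin.val_add, Fin.val_one', Nat.mod_eq_of_lt (by omega : 1 < n)] at h0
    have := (y 0).2
    by_cases h1 : (y 0 : ℕ) + 1 = n
    · rw [h1, Nat.mod_self] at h0; omega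
    · rw [Nat.mod_eq_of_lt (by omega)] at h0; omega
  have hreach : ∀ s a : Fin n, ∃ k : ℕ, (fun x : Fin n => x + 1)^[k] a = s := by
    intro s a
    refine ⟨s + (n - a), Fin.ext ?_⟩
    have := a.2
    rw [val_iterate_add_one, show (a : ℕ) + (s + (n - a)) = s + n by omega, Nat.add_mod_right,
      Nat.mod_eq_of_lt s.2]
  have hlimc : ∀ y, (cyclic next y Ordinal.omega0).IsLimit := fun y =>
    cyclic_isLimit _ _ Ordinal.omega0_pos
  refine ⟨Γ (cyclic next (f 0) Ordinal.omega0) 0, ?_⟩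
  set s := Γ (cyclic next (f 0) Ordinal.omega0) 0 with hs
  intro H c hH hwalk hnot
  -- The limit `s` was defined with the cycle entered at `0`; entering it at `s` itself gives the
  -- same limit, so `s` can serve as the restart symbol.
  have hval : Γ (cyclic next (f s) Ordinal.omega0) 0 = s := by
    obtain ⟨k, hk⟩ := hreach s 0
    have hlt : Ordinal.omega0 * (k : Ordinal.{u}) < (cyclic next (f 0) Ordinal.omega0).len :=
      mul_lt_mul_of_pos_left (Ordinal.natCast_lt_omega0 k) Ordinal.omega0_pos
    conv_rhs => rw [hs, hΓ.asymptotic _ _ (hlimc _) (drop_isFinalSegment _ hlt.le)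
      (drop_len_pos _ hlt), drop_cyclic, hsemi, hk]
  -- Copying the history of `c` into every cell does not change its limit.
  have h1 : Γ H c = Γ ((H.map fun y => y c).map f) 0 := by
    rw [← hγ H hH c, ← hγ ((H.map fun y => y c).map f) hH 0]
    rfl
  obtain ⟨i, hi, hvisit⟩ := hwalk.exists_get_eq_base (hreach s) hH.bot_lt hnot
  rw [h1, (hwalk.map hf (next' := next) fun _ => rfl).eq_cyclic hΓ.asymptotic
    hΓ.contractionProof hloop hne (by omega : 0 < n) ?_ ⟨i, hi, congrArg f hvisit⟩ hH ?_, hval]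
  · rw [hsemi]
    congr 1
    exact Fin.ext (by rw [val_iterate_add_one, Nat.add_mod_right, Nat.mod_eq_of_lt s.2])
  · exact fun κ hκ y hy => hnot κ hκ _ (hy.of_map hf hκ le_rfl).1

/-- An operator for which a cell whose history walks along the cycle `1, 0, 2, …, n - 1` has the
limit value `1` if it has not stabilized, and the stable value otherwise. -/
structure IsCycleSup (hn : 2 ≤ n) (Γ : LimitOperator.{u} n) : Prop where
  apply_const : ∀ (H : OrdWord.{u} (ℕ → Fin n)) (c : ℕ) (κ : Ordinal.{u}) (x : Fin n), H.IsLimit →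
    κ < H.len → (H.map fun y => y c).ConstOn κ H.len x → Γ H c = x
  apply_walk : ∀ (H : OrdWord.{u} (ℕ → Fin n)) (c : ℕ), H.IsLimit →
    (H.map fun y => y c).IsWalk (cycNext hn) (Fin.castLE hn 1) →
    (∀ κ < H.len, ∀ x, ¬ (H.map fun y => y c).ConstOn κ H.len x) → Γ H c = Fin.castLE hn 1

theorem Simulational.exists_isCycleSup_rename [NeZero n] (hn : 2 ≤ n) (hΓ : Γ.Simulational)
    (hloop : Γ.LoopingStable) : ∃ σ : Equiv.Perm (Fin n), (Γ.rename σ).IsCycleSup hn := by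
  obtain ⟨s, hs⟩ := hΓ.exists_cycle_value hn hloop
  -- Subtracting `s` sends `s` to `0` and `s + 1` to `1`; the swap then sends them to `1` and `0`.
  let σ : Equiv.Perm (Fin n) := (Equiv.subRight s).trans (Equiv.swap 0 1)
  have hone : Fin.castLE hn 1 = (1 : Fin n) :=
    Fin.ext (by rw [Fin.val_one', Nat.mod_eq_of_lt (by omega)]; rfl)
  have hσs : σ s = Fin.castLE hn 1 := by
    simp [σ, hone]
  have hnext : ∀ x, σ (x + 1) = cycNext hn (σ x) := by
    intro x
    change Equiv.swap 0 1 (x + 1 - s) = cycNext hn (Equiv.swap 0 1 (x - s))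
    rw [cycNext_swap, add_sub_right_comm]
  refine ⟨σ, ⟨?_, ?_⟩⟩
  · intro H c κ x hH hκ h
    refine (Equiv.eq_symm_apply σ).1 ?_
    exact hΓ.stable.apply_eventually_const hΓ.cellByCell hΓ.asymptotic
      (H := H.map fun x d => σ.symm (x d)) hH hκ
      fun ξ hξ h1 h2 => congrArg σ.symm (h ξ hξ h1 h2)
  · intro H c hH h hnot
    rw [← hσs]
    refine congrArg σ (hs (H.map fun x d => σ.symm (x d)) c hH ?_ ?_)
    · have := h.map σ.symm.injective (next' := fun x => x + 1) fun x => by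
        rw [Equiv.symm_apply_eq, hnext, Equiv.apply_symm_apply]
      rwa [← hσs, Equiv.symm_apply_apply] at this
    · intro κ hκ x hx
      have hx' : ((H.map fun y => y c).map σ.symm).ConstOn κ H.len x := hx
      exact hnot κ hκ _ (hx'.of_map σ.symm.injective hκ le_rfl).1

end LimitOperator
end InfTM

/-! ### Limit values of `sup`, and runs of machines. -/

namespace InfTM
open OrdWord

namespace LimitOperator

theorem sup_apply_const {H : OrdWord.{u} (ℕ → Fin 2)} {c : ℕ} {κ : Ordinal.{u}}
    (hκ : κ < H.len) {x : Fin 2} (h : (H.map fun y => y c).ConstOn κ H.len x) : sup H c = x := by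
  unfold sup
  split_ifs with h0
  · obtain ⟨β, hβ, h1⟩ := h0
    have hm := max_lt hκ hβ
    rw [← h1 _ hm (le_max_right _ _)]
    exact h _ hm (le_max_left _ _) hm
  · by_contra hx
    have hx0 : x = 0 := by omega
    subst hx0
    exact h0 ⟨κ, hκ, fun δ hδ h1 => h δ hδ h1 hδ⟩

theorem sup_apply_of_not_const {H : OrdWord.{u} (ℕ → Fin 2)} {c : ℕ}
    (h : ∀ κ < H.len, ∀ x, ¬ (H.map fun y => y c).ConstOn κ H.len x) : sup H c = 1 := by
  unfold sup
  rw [if_neg]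
  rintro ⟨β, hβ, h1⟩
  exact h β hβ 0 fun ξ hξ h2 _ => h1 ξ hξ h2

end LimitOperator

namespace Machine
variable {n : ℕ}

theorem step_of_halted (M : Machine n) {s : Snapshot n M.State} (h : s.state = M.halt) : M.step s = s := by
  unfold step
  rw [if_pos h]

section Run
variable [NeZero n] (M : Machine n) (Γ : LimitOperator.{u} n) (y : ℕ → Fin n)

theorem run_zero : M.run Γ y 0 = M.init y := Ordinal.limitRecOn_zero ..

theorem run_add_one (α : Ordinal.{u}) : M.run Γ y (α + 1) = M.step (M.run Γ y α) :=
  Ordinal.limitRecOn_add_one ..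

/-- The history of the tapes before the stage `μ`. -/
noncomputable def history (μ : Ordinal.{u}) : OrdWord.{u} (ℕ → Fin n) :=
  ⟨μ, fun β _ => (M.run Γ y β).tape⟩

open Classical in
theorem run_limit_eq {μ : Ordinal.{u}} (hμ : Order.IsSuccLimit μ) :
    M.run Γ y μ = if h : ∃ (β : Ordinal.{u}) (_ : β < μ), (M.run Γ y β).state = M.halt then
      M.run Γ y h.choose else ⟨M.limit, 0, Γ (M.history Γ y μ)⟩ :=
  Ordinal.limitRecOn_limit _ _ _ _ hμ

theorem run_limit_of_not_halted {μ : Ordinal.{u}} (hμ : Order.IsSuccLimit μ)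
    (h : ∀ β < μ, (M.run Γ y β).state ≠ M.halt) :
    M.run Γ y μ = ⟨M.limit, 0, Γ (M.history Γ y μ)⟩ := by
  rw [run_limit_eq M Γ y hμ, dif_neg]
  rintro ⟨β, hβ, h'⟩
  exact h β hβ h'

theorem run_of_halted {β α : Ordinal.{u}} (h : (M.run Γ y β).state = M.halt) (hα : β ≤ α) :
    M.run Γ y α = M.run Γ y β := by
  induction α using WellFoundedLT.induction generalizing β with
  | ind α ih =>
    rcases hα.eq_or_lt with rfl | hlt
    · rfl
    rcases Ordinal.zero_or_succ_or_isSuccLimit α with rfl | ⟨ν, rfl⟩ | hl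
    · exact absurd hlt (not_lt.2 zero_le)
    · have hν : β ≤ ν := Order.lt_succ_iff.1 hlt
      have h1 := ih ν (Order.lt_succ ν) h hν
      rw [Order.succ_eq_add_one, run_add_one, h1, step_of_halted M h]
    · have hex : ∃ (β : Ordinal.{u}) (_ : β < α), (M.run Γ y β).state = M.halt := ⟨β, hlt, h⟩
      rw [run_limit_eq M Γ y hl, dif_pos hex]
      obtain ⟨h1, h2⟩ := hex.choose_spec
      -- The limit stage copies an unspecified halted stage; of two halted stages, the later one
      -- repeats the earlier one.
      rcases le_total β hex.choose with h3 | h3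
      · exact ih _ h1 h h3
      · exact (ih β hlt h2 h3).symm

theorem run_add_natCast (α : Ordinal.{u}) (i : ℕ) :
    M.run Γ y (α + i) = M.step^[i] (M.run Γ y α) := by
  induction i with
  | zero => simp
  | succ i ih =>
    rw [Function.iterate_succ_apply', ← ih, ← run_add_one]
    push_cast
    rw [add_assoc]

end Run

theorem cell_div (t : Fin 3) (i : ℕ) : cell t i / 3 = i := by
  unfold cell; omega

theorem ofNat_cell (t : Fin 3) (i : ℕ) : Fin.ofNat 3 (cell t i) = t :=
  Fin.ext (by simp only [Fin.val_ofNat, cell]; omega)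

theorem cell_ofNat (c : ℕ) : cell (Fin.ofNat 3 c) (c / 3) = c := by
  simp only [cell, Fin.val_ofNat]; omega

/-! ### The emulating machine, step by step. -/

variable (hn : 2 ≤ n) (M : Machine 2)

/-- The step of `M` from the state `q` with the symbols `r` under the head, for the machine which
lets the cells that change from `0` to `1` go through the symbols `2, …, n - 1`, and where
they have now the symbol `k` (`k = 1` at the beginning). -/
def simTrans (q : M.State) (r : Fin 3 → Fin 2) (k : ℕ) :
    (M.State ⊕ (M.State × (Fin 3 → Fin 2) × Fin n)) × (Fin 3 → Fin n) × Move :=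
  if h : k + 1 < n ∧ ∃ t, r t = 0 ∧ (M.trans q r).2.1 t = 1 then
    (.inr (q, r, ⟨k + 1, h.1⟩),
      fun t => if r t = 0 ∧ (M.trans q r).2.1 t = 1 then ⟨k + 1, h.1⟩ else Fin.castLE hn (r t),
      .stay)
  else (.inl (M.trans q r).1, fun t => Fin.castLE hn ((M.trans q r).2.1 t), (M.trans q r).2.2)

/-- The `n`-symbol machine which emulates the `2`-symbol machine `M`. -/
def sim : Machine n where
  State := M.State ⊕ (M.State × (Fin 3 → Fin 2) × Fin n)
  finite := by
    have := M.finite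
    infer_instance
  start := .inl M.start
  limit := .inl M.limit
  halt := .inl M.halt
  trans
    -- In the snapshots reached with such a state all symbols are `0` or `1`, so the value given to
    -- other symbols is arbitrary.
    | .inl q, s => M.simTrans hn q (fun t => if (s t : ℕ) = 1 then 1 else 0) 1
    | .inr (q, r, k), _ => M.simTrans hn q r k

/-- The symbols under the head. -/
def read (s : Snapshot 2 M.State) : Fin 3 → Fin 2 := fun t => s.tape (cell t s.head)

/-- The next step changes the cell `c` from `0` to `1`. -/
def Rises (s : Snapshot 2 M.State) (c : ℕ) : Prop := s.tape c = 0 ∧ (M.step s).tape c = 1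

open Classical in
/-- The snapshot of `M.sim` where the cells that the next step of `M` from `s` changes from `0` to
`1` have the symbol `k`, for `2 ≤ k < n`; for other values of `k`, the snapshot that matches `s`. -/
noncomputable def phase (s : Snapshot 2 M.State) (k : ℕ) : Snapshot n (M.sim hn).State where
  state := if h : 2 ≤ k ∧ k < n then .inr (s.state, M.read s, ⟨k, h.2⟩) else .inl s.state
  head := s.head
  tape c := if h : (2 ≤ k ∧ k < n) ∧ M.Rises s c then ⟨k, h.1.2⟩ else Fin.castLE hn (s.tape c)

variable {M}

theorem not_rises_of_halted {s : Snapshot 2 M.State} (h : s.state = M.halt) (c : ℕ) :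
    ¬ M.Rises s c := by
  rintro ⟨h0, h1⟩
  rw [step_of_halted M h, h0] at h1
  exact absurd h1 (by decide)

theorem rises_iff {s : Snapshot 2 M.State} (h : s.state ≠ M.halt) (c : ℕ) :
    M.Rises s c ↔ c / 3 = s.head ∧ M.read s (Fin.ofNat 3 c) = 0 ∧
      (M.trans s.state (M.read s)).2.1 (Fin.ofNat 3 c) = 1 := by
  unfold Rises step
  rw [if_neg h]
  change (s.tape c = 0 ∧ (if c / 3 = s.head then (M.trans s.state (M.read s)).2.1 (Fin.ofNat 3 c)
    else s.tape c) = 1) ↔ _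
  by_cases hc : c / 3 = s.head
  · have : M.read s (Fin.ofNat 3 c) = s.tape c := by
      unfold read
      rw [← hc, cell_ofNat]
    rw [if_pos hc, this]
    simp only [hc, true_and]
  · simp only [hc, if_false, false_and, iff_false]
    rintro ⟨h0, h1⟩
    rw [h0] at h1
    exact absurd h1 (by decide)

theorem exists_rises_iff {s : Snapshot 2 M.State} (h : s.state ≠ M.halt) :
    (∃ c, M.Rises s c) ↔ ∃ t, M.read s t = 0 ∧ (M.trans s.state (M.read s)).2.1 t = 1 := by
  constructor
  · rintro ⟨c, hc⟩
    exact ⟨_, ((rises_iff h c).1 hc).2⟩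
  · rintro ⟨t, ht⟩
    refine ⟨cell t s.head, (rises_iff h _).2 ⟨cell_div _ _, ?_⟩⟩
    rwa [ofNat_cell]

theorem phase_tape_of_rises {s : Snapshot 2 M.State} {k : ℕ} (hk2 : 2 ≤ k) (hk : k < n) {c : ℕ}
    (hc : M.Rises s c) : (phase hn M s k).tape c = ⟨k, hk⟩ :=
  dif_pos ⟨⟨hk2, hk⟩, hc⟩

theorem phase_tape_of_not_rises {s : Snapshot 2 M.State} (k : ℕ) {c : ℕ}
    (hc : ¬ M.Rises s c) : (phase hn M s k).tape c = Fin.castLE hn (s.tape c) :=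
  dif_neg fun h => hc h.2

theorem phase_one_tape (s : Snapshot 2 M.State) (c : ℕ) :
    (phase hn M s 1).tape c = Fin.castLE hn (s.tape c) :=
  rfl

theorem phase_one_state (s : Snapshot 2 M.State) : (phase hn M s 1).state = .inl s.state :=
  rfl

/-- In an intermediate phase the original symbols under the head have been overwritten, but the
state remembers them. -/
theorem trans_phase {s : Snapshot 2 M.State} {k : ℕ} (hk1 : 1 ≤ k) (hk : k < n) :
    (M.sim hn).trans (phase hn M s k).state
      (fun t => (phase hn M s k).tape (cell t (phase hn M s k).head))
      = M.simTrans hn s.state (M.read s) k := by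
  by_cases h2 : 2 ≤ k
  · have : (phase hn M s k).state = .inr (s.state, M.read s, ⟨k, hk⟩) := dif_pos ⟨h2, hk⟩
    rw [this]
    rfl
  · obtain rfl : k = 1 := by omega
    have : (phase hn M s 1).state = .inl s.state := phase_one_state hn s
    rw [this]
    change M.simTrans hn s.state (fun t => if (((phase hn M s 1).tape (cell t s.head) : Fin n) : ℕ)
      = 1 then 1 else 0) 1 = _
    congr 1
    funext t
    have : (phase hn M s 1).tape (cell t s.head) = Fin.castLE hn (M.read s t) :=
      phase_one_tape hn s _
    rw [this]
    generalize M.read s t = x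
    fin_cases x <;> rfl

theorem phase_state_ne_halt {s : Snapshot 2 M.State} {k : ℕ} (hs : s.state ≠ M.halt) :
    (phase hn M s k).state ≠ (M.sim hn).halt := by
  by_cases h : 2 ≤ k ∧ k < n
  · have h1 : (phase hn M s k).state = .inr _ := dif_pos h
    rw [h1]
    exact Sum.inr_ne_inl
  · have h1 : (phase hn M s k).state = .inl s.state := dif_neg h
    rw [h1]
    exact fun h => hs (Sum.inl_injective h)

theorem step_phase {s : Snapshot 2 M.State} {k : ℕ} (hk1 : 1 ≤ k) (hk : k < n)
    (hs : s.state ≠ M.halt) : (M.sim hn).step (phase hn M s k) =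
      { state := (M.simTrans hn s.state (M.read s) k).1
        head := (M.simTrans hn s.state (M.read s) k).2.2.apply s.head
        tape := fun c => if c / 3 = s.head then
            (M.simTrans hn s.state (M.read s) k).2.1 (Fin.ofNat 3 c)
          else Fin.castLE hn (s.tape c) } := by
  unfold step
  rw [if_neg (phase_state_ne_halt hn hs)]
  simp only [trans_phase hn hk1 hk]
  congr 1
  funext c
  by_cases hc : c / 3 = s.head
  · rw [if_pos hc]
    exact if_pos hc
  · rw [if_neg hc, ← phase_tape_of_not_rises hn k (s := s) fun h => hc ((rises_iff hs c).1 h).1]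
    exact if_neg hc

theorem step_phase_of_rises {s : Snapshot 2 M.State} {k : ℕ} (hk1 : 1 ≤ k) (hk : k + 1 < n)
    (hr : ∃ c, M.Rises s c) :
    (M.sim hn).step (phase hn M s k) = phase hn M s (k + 1) := by
  have hs : s.state ≠ M.halt := fun h => hr.elim fun c hc => not_rises_of_halted h c hc
  have hT : M.simTrans hn s.state (M.read s) k = _ := dif_pos ⟨hk, (exists_rises_iff hs).1 hr⟩
  rw [step_phase hn hk1 (by omega) hs, hT]
  ext1
  · exact (dif_pos ⟨by omega, hk⟩ : (phase hn M s (k + 1)).state = _).symm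
  · rfl
  · funext c
    by_cases hrc : M.Rises s c
    · rw [phase_tape_of_rises hn (by omega) hk hrc]
      have h := (rises_iff hs c).1 hrc
      simp only
      rw [if_pos h.1, if_pos h.2]
    · rw [phase_tape_of_not_rises hn _ hrc]
      by_cases hc : c / 3 = s.head
      · have h : ¬ (M.read s (Fin.ofNat 3 c) = 0 ∧
            (M.trans s.state (M.read s)).2.1 (Fin.ofNat 3 c) = 1) :=
          fun h => hrc ((rises_iff hs c).2 ⟨hc, h⟩)
        simp only
        rw [if_pos hc, if_neg h, read, ← hc, cell_ofNat]
      · simp only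
        rw [if_neg hc]

/-- Either no cell rises, or the rising cells have used up the extra symbols. The last hypothesis
excludes intermediate phases without a rising cell; in particular a halted snapshot occurs only with
`k = 1`, and both machines keep it. -/
theorem step_phase_of_not {s : Snapshot 2 M.State} {k : ℕ} (hk1 : 1 ≤ k) (hk : k < n)
    (hr : ¬ (k + 1 < n ∧ ∃ c, M.Rises s c)) (hkr : k = 1 ∨ ∃ c, M.Rises s c) :
    (M.sim hn).step (phase hn M s k) = phase hn M (M.step s) 1 := by
  by_cases hs : s.state = M.halt
  · have hk' : k = 1 :=
      hkr.resolve_right fun ⟨c, hc⟩ => not_rises_of_halted hs c hc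
    subst hk'
    rw [step_of_halted M hs, step_of_halted]
    rw [phase_one_state, hs]
    rfl
  have hT : M.simTrans hn s.state (M.read s) k = _ :=
    dif_neg (by rwa [← exists_rises_iff hs])
  rw [step_phase hn hk1 hk hs, hT]
  have hstep : M.step s = _ := if_neg hs
  ext1
  · rw [phase_one_state, hstep]
    rfl
  · change _ = (M.step s).head
    rw [hstep]
    rfl
  · funext c
    rw [phase_one_tape, hstep]
    simp only
    split_ifs <;> rfl

theorem fin_two_cases (x x' : Fin 2) : x = x' ∨ (x = 0 ∧ x' = 1) ∨ (x = 1 ∧ x' = 0) := by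
  omega

/-- In each step, each cell keeps its symbol or gets the next one in the cyclic order. -/
theorem step_phase_tape {s : Snapshot 2 M.State} {k : ℕ} (hk1 : 1 ≤ k) (hk : k < n)
    (hkr : k = 1 ∨ ∃ c, M.Rises s c) (c : ℕ) :
    ((M.sim hn).step (phase hn M s k)).tape c = (phase hn M s k).tape c ∨
      ((M.sim hn).step (phase hn M s k)).tape c = cycNext hn ((phase hn M s k).tape c) := by
  have hphase : M.Rises s c → ((phase hn M s k).tape c : ℕ) = if k = 1 then 0 else k := by
    intro hc
    split_ifs with h1
    · rw [h1, phase_one_tape, hc.1]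
      rfl
    · rw [phase_tape_of_rises hn (by omega) hk hc]
  have hcyc : ∀ x : Fin n, ((cycNext hn x : Fin n) : ℕ)
      = if (x : ℕ) = 1 then (0 : ℕ)
        else if max (x : ℕ) 1 + 1 < n then max (x : ℕ) 1 + 1 else (1 : ℕ) := by
    intro x
    unfold cycNext
    split_ifs <;> rfl
  by_cases h : k + 1 < n ∧ ∃ c, M.Rises s c
  · rw [step_phase_of_rises hn hk1 h.1 h.2]
    by_cases hc : M.Rises s c
    · right
      refine Fin.ext ?_
      rw [hcyc, hphase hc, phase_tape_of_rises hn (by omega) h.1 hc]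
      grind
    · left
      rw [phase_tape_of_not_rises hn _ hc, phase_tape_of_not_rises hn _ hc]
  · rw [step_phase_of_not hn hk1 hk h hkr, phase_one_tape]
    by_cases hc : M.Rises s c
    · right
      have hk' : ¬ k + 1 < n := fun h' => h ⟨h', c, hc⟩
      refine Fin.ext ?_
      rw [hcyc, hphase hc, hc.2]
      change 1 = _
      grind
    · rw [phase_tape_of_not_rises hn _ hc]
      rcases fin_two_cases (s.tape c) ((M.step s).tape c) with h1 | h1 | h1
      · exact Or.inl (by rw [h1])
      · exact absurd h1 hc
      · right
        rw [h1.1, h1.2]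
        refine Fin.ext ?_
        rw [hcyc]
        rfl

end Machine
end InfTM

/-! ### Comparison of the two runs. -/

namespace InfTM
open OrdWord

namespace Machine
variable {n : ℕ} (hn : 2 ≤ n) (M : Machine 2)

open Classical in
/-- The number of snapshots that `M.sim` inserts between those of `s` and of the next step. -/
noncomputable def delay (n : ℕ) (s : Snapshot 2 M.State) : ℕ :=
  if ∃ c, M.Rises s c then n - 2 else 0

/-- The number of steps of `M.sim` for the first `j` steps of `M` from `s`. -/
noncomputable def simTime (n : ℕ) (s : Snapshot 2 M.State) : ℕ → ℕ
  | 0 => 0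
  | j + 1 => simTime n s j + M.delay n (M.step^[j] s) + 1

theorem simTime_strictMono (s : Snapshot 2 M.State) : StrictMono (M.simTime n s) :=
  strictMono_nat_of_lt_succ fun j => by
    change _ < M.simTime n s j + M.delay n (M.step^[j] s) + 1
    omega

/-- The step `i` falls in the delay that follows the `j`-th emulated snapshot, at rank `k`. -/
theorem exists_simTime_add_eq (s : Snapshot 2 M.State) (i : ℕ) :
    ∃ j k, k ≤ M.delay n (M.step^[j] s) ∧ M.simTime n s j + k = i := by
  induction i with
  | zero => exact ⟨0, 0, Nat.zero_le _, rfl⟩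
  | succ i ih =>
    obtain ⟨j, k, hk, h⟩ := ih
    rcases hk.eq_or_lt with h1 | h1
    · refine ⟨j + 1, 0, Nat.zero_le _, ?_⟩
      change M.simTime n s j + M.delay n (M.step^[j] s) + 1 + 0 = i + 1
      omega
    · exact ⟨j, k + 1, h1, by omega⟩

variable {M}

theorem rises_of_lt_delay {s : Snapshot 2 M.State} {k : ℕ} (h : k < M.delay n s) :
    k + 2 < n ∧ ∃ c, M.Rises s c := by
  unfold delay at h
  split_ifs at h with h1
  · exact ⟨by omega, h1⟩
  · omega

theorem add_one_lt_of_le_delay (hn : 2 ≤ n) {s : Snapshot 2 M.State} {k : ℕ} (h : k ≤ M.delay n s) :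
    k + 1 < n ∧ (k + 1 = 1 ∨ ∃ c, M.Rises s c) := by
  rcases k with _ | k
  · exact ⟨by omega, Or.inl rfl⟩
  · have := rises_of_lt_delay (Nat.lt_of_succ_le h)
    exact ⟨by omega, Or.inr this.2⟩

theorem iterate_step_phase {s : Snapshot 2 M.State} {k : ℕ} (hk : k ≤ M.delay n s) :
    (M.sim hn).step^[k] (phase hn M s 1) = phase hn M s (k + 1) := by
  induction k with
  | zero => rfl
  | succ k ih =>
    have h := rises_of_lt_delay (Nat.lt_of_succ_le hk)
    rw [Function.iterate_succ_apply', ih (by omega),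
      step_phase_of_rises hn (by omega) (by omega) h.2]

theorem iterate_step_delay_add_one (s : Snapshot 2 M.State) :
    (M.sim hn).step^[M.delay n s + 1] (phase hn M s 1) = phase hn M (M.step s) 1 := by
  have h := add_one_lt_of_le_delay hn (le_refl (M.delay n s))
  rw [Function.iterate_succ_apply', iterate_step_phase hn le_rfl,
    step_phase_of_not hn (by omega) h.1 ?_ h.2]
  rintro ⟨h1, h2⟩
  unfold delay at h1
  rw [if_pos h2] at h1
  omega

theorem iterate_step_simTime (s : Snapshot 2 M.State) (j : ℕ) :
    (M.sim hn).step^[M.simTime n s j] (phase hn M s 1) = phase hn M (M.step^[j] s) 1 := by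
  induction j with
  | zero => rfl
  | succ j ih =>
    change (M.sim hn).step^[M.simTime n s j + M.delay n (M.step^[j] s) + 1] _ = _
    rw [add_assoc, add_comm, Function.iterate_add_apply, ih, iterate_step_delay_add_one,
      Function.iterate_succ_apply']

theorem iterate_step_simTime_add {s : Snapshot 2 M.State} {j k : ℕ}
    (hk : k ≤ M.delay n (M.step^[j] s)) :
    (M.sim hn).step^[M.simTime n s j + k] (phase hn M s 1)
      = phase hn M (M.step^[j] s) (k + 1) := by
  rw [add_comm, Function.iterate_add_apply, iterate_step_simTime, iterate_step_phase hn hk]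

section Emulation
variable [NeZero n] (M) (Γ : LimitOperator.{u} n) (y : ℕ → Fin 2)

/-- The run of the emulating machine. -/
noncomputable def simRun (α : Ordinal.{u}) : Snapshot n (M.sim hn).State :=
  (M.sim hn).run Γ (fun i => Fin.castLE hn (y i)) α

/-- The run of the emulated machine. -/
noncomputable def supRun (α : Ordinal.{u}) : Snapshot 2 M.State :=
  M.run LimitOperator.sup y α

/-- The two runs match at all the stages below `μ` that are `0` or limits. -/
def MatchBelow (μ : Ordinal.{u}) : Prop :=
  ∀ ν < μ, ν = 0 ∨ Order.IsSuccLimit ν → M.simRun hn Γ y ν = phase hn M (M.supRun y ν) 1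

variable {M Γ y}

theorem exists_eq_add_natCast (α : Ordinal.{u}) :
    ∃ (ν : Ordinal.{u}) (i : ℕ), (ν = 0 ∨ Order.IsSuccLimit ν) ∧ α = ν + i := by
  refine ⟨Ordinal.omega0 * (α / Ordinal.omega0), finPart α, ?_, eq_omega0_mul_add_finPart α⟩
  rcases eq_or_ne (α / Ordinal.omega0) 0 with h | h
  · exact Or.inl (by rw [h, mul_zero])
  · exact Or.inr (Ordinal.isSuccLimit_mul_left Ordinal.isSuccLimit_omega0 (pos_iff_ne_zero.2 h))

theorem add_natCast_lt {μ ν : Ordinal.{u}} (hμ : Order.IsSuccLimit μ) (h : ν < μ) (i : ℕ) :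
    ν + i < μ := by
  induction i with
  | zero => simpa using h
  | succ i ih =>
    have := hμ.add_one_lt ih
    push_cast
    rwa [← add_assoc]

/-- Emulation keeps the order of the snapshots: once that of `β` is displayed, at a stage not before
`β`, only phases of later snapshots of `M` follow. This transfers eventual constancy between the two
histories. -/
theorem MatchBelow.phase_after {μ : Ordinal.{u}} (h : M.MatchBelow hn Γ y μ)
    (hμ : Order.IsSuccLimit μ) {β : Ordinal.{u}} (hβ : β < μ) :
    ∃ δ < μ, β ≤ δ ∧ M.simRun hn Γ y δ = phase hn M (M.supRun y β) 1 ∧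
      ∀ δ' < μ, δ ≤ δ' → ∃ (β' : Ordinal.{u}) (k : ℕ), β ≤ β' ∧ β' ≤ δ' ∧
        k ≤ M.delay n (M.supRun y β') ∧
        M.simRun hn Γ y δ' = phase hn M (M.supRun y β') (k + 1) := by
  have hN : ∀ (ν : Ordinal.{u}) (i : ℕ),
      M.simRun hn Γ y (ν + i) = (M.sim hn).step^[i] (M.simRun hn Γ y ν) := fun ν i =>
    run_add_natCast _ _ _ ν i
  have hM : ∀ (ν : Ordinal.{u}) (j : ℕ), M.supRun y (ν + j) = M.step^[j] (M.supRun y ν) :=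
    fun ν j => run_add_natCast _ _ _ ν j
  obtain ⟨ν, j, hν, rfl⟩ := exists_eq_add_natCast β
  have hνμ : ν < μ := le_self_add.trans_lt hβ
  have hle : ∀ (ν : Ordinal.{u}) (j : ℕ), ν + (j : Ordinal.{u}) ≤ ν + (M.simTime n (M.supRun y ν) j : ℕ) := by
    intro ν j
    have := (M.simTime_strictMono (n := n) (M.supRun y ν)).le_apply (x := j)
    gcongr
  refine ⟨ν + (M.simTime n (M.supRun y ν) j : ℕ), add_natCast_lt hμ hνμ _, hle ν j, ?_, ?_⟩
  · rw [hN, hM, h ν hνμ hν, iterate_step_simTime]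
  · intro δ' hδ' hle'
    obtain ⟨ν', i, hν', rfl⟩ := exists_eq_add_natCast δ'
    have hν'μ : ν' < μ := le_self_add.trans_lt hδ'
    obtain ⟨j', k, hk, hi⟩ := exists_simTime_add_eq M (n := n) (M.supRun y ν') i
    refine ⟨ν' + j', k, ?_, (hle ν' j').trans ?_, by rwa [hM], ?_⟩
    · rcases lt_trichotomy ν ν' with h1 | rfl | h1
      · rcases hν' with rfl | hν'
        · exact absurd h1 (not_lt.2 zero_le)
        · exact (add_natCast_lt hν' h1 j).le.trans le_self_add
      · have h2 : M.simTime n (M.supRun y ν) j ≤ i := by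
          rw [add_le_add_iff_left] at hle'
          exact_mod_cast hle'
        have h3 : j ≤ j' := by
          by_contra h3
          have h4 := (M.simTime_strictMono (n := n) (M.supRun y ν)).monotone
            (show j' + 1 ≤ j by omega)
          change M.simTime n (M.supRun y ν) j' + M.delay n (M.step^[j'] (M.supRun y ν)) + 1 ≤ _
            at h4
          omega
        gcongr
      · exfalso
        rcases hν with rfl | hν
        · exact absurd h1 (not_lt.2 zero_le)
        · exact absurd hle' (not_le.2 ((add_natCast_lt hν h1 i).trans_le le_self_add))
    · have : M.simTime n (M.supRun y ν') j' ≤ i := by omega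
      gcongr
    · rw [hN, hM, h ν' hν'μ hν', ← hi, iterate_step_simTime_add hn hk]

theorem MatchBelow.phase_at {μ : Ordinal.{u}} (h : M.MatchBelow hn Γ y μ)
    {δ : Ordinal.{u}} (hδ : δ < μ) :
    ∃ (β : Ordinal.{u}) (k : ℕ), β ≤ δ ∧ k ≤ M.delay n (M.supRun y β) ∧
      M.simRun hn Γ y δ = phase hn M (M.supRun y β) (k + 1) := by
  obtain ⟨ν, i, hν, rfl⟩ := exists_eq_add_natCast δ
  have hνμ : ν < μ := le_self_add.trans_lt hδ
  obtain ⟨j, k, hk, hi⟩ := exists_simTime_add_eq M (n := n) (M.supRun y ν) i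
  have hM : M.supRun y (ν + j) = M.step^[j] (M.supRun y ν) := run_add_natCast _ _ _ ν j
  refine ⟨ν + j, k, ?_, by rwa [hM], ?_⟩
  · have := (M.simTime_strictMono (n := n) (M.supRun y ν)).le_apply (x := j)
    have : j ≤ i := by omega
    gcongr
  · have hN : M.simRun hn Γ y (ν + i) = (M.sim hn).step^[i] (M.simRun hn Γ y ν) :=
      run_add_natCast _ _ _ ν i
    rw [hN, hM, h ν hνμ hν, ← hi, iterate_step_simTime_add hn hk]

/-- The history of the cell `c` of the emulating machine. -/
noncomputable def simCell (M : Machine 2) (Γ : LimitOperator.{u} n) (y : ℕ → Fin 2) (c : ℕ)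
    (μ : Ordinal.{u}) : OrdWord.{u} (Fin n) :=
  ((M.sim hn).history Γ (fun i => Fin.castLE hn (y i)) μ).map fun x => x c

/-- The history of the cell `c` of the emulated machine. -/
noncomputable def supCell (M : Machine 2) (y : ℕ → Fin 2) (c : ℕ) (μ : Ordinal.{u}) :
    OrdWord.{u} (Fin 2) :=
  (M.history LimitOperator.sup y μ).map fun x => x c

/-- A cell that is constant from `β` on has no rises left, so the intermediate phases leave it
untouched. -/
theorem MatchBelow.constOn_simCell {μ : Ordinal.{u}} (h : M.MatchBelow hn Γ y μ)
    (hμ : Order.IsSuccLimit μ) {c : ℕ} {β : Ordinal.{u}} (hβ : β < μ) {x : Fin 2}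
    (hx : (M.supCell y c μ).ConstOn β μ x) :
    ∃ δ < μ, (M.simCell hn Γ y c μ).ConstOn δ μ (Fin.castLE hn x) := by
  obtain ⟨δ, hδ, -, -, hafter⟩ := h.phase_after hn hμ hβ
  refine ⟨δ, hδ, fun ξ hξ h1 _ => ?_⟩
  obtain ⟨β', k, hβ', hle, -, hrun⟩ := hafter ξ hξ h1
  have hlt : β' < μ := hle.trans_lt hξ
  have e1 : (M.supRun y β').tape c = x := hx β' hlt hβ' hlt
  -- Whether the cell rises at `β'` depends on the stage `β' + 1`, which is still below the limit
  -- `μ`.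
  have hlt' := hμ.add_one_lt hlt
  have e2 : (M.supRun y (β' + 1)).tape c = x :=
    hx _ hlt' (hβ'.trans le_self_add) hlt'
  have e3 : M.supRun y (β' + 1) = M.step (M.supRun y β') := run_add_one _ _ _ _
  rw [e3] at e2
  have hr : ¬ M.Rises (M.supRun y β') c := by
    rintro ⟨r1, r2⟩
    rw [e1] at r1
    rw [e2, r1] at r2
    exact absurd r2 (by decide)
  change (M.simRun hn Γ y ξ).tape c = _
  rw [hrun, phase_tape_of_not_rises hn _ hr, e1]

/-- Every snapshot of `M` from `δ` on is displayed by the emulating machine at some stage that is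
also not before `δ`. -/
theorem MatchBelow.constOn_supCell {μ : Ordinal.{u}} (h : M.MatchBelow hn Γ y μ)
    (hμ : Order.IsSuccLimit μ) {c : ℕ} {δ : Ordinal.{u}} (hδ : δ < μ) {z : Fin n}
    (hz : (M.simCell hn Γ y c μ).ConstOn δ μ z) :
    ∃ x, (M.supCell y c μ).ConstOn δ μ x := by
  have key : ∀ β < μ, δ ≤ β → Fin.castLE hn ((M.supRun y β).tape c) = z := by
    intro β hβ hle
    obtain ⟨δ', hδ', hle', hrun, -⟩ := h.phase_after hn hμ hβ
    have h1 : (M.simRun hn Γ y δ').tape c = z := hz δ' hδ' (hle.trans hle') hδ'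
    rwa [hrun, phase_one_tape] at h1
  refine ⟨(M.supRun y δ).tape c, fun ξ hξ h1 _ => ?_⟩
  exact Fin.castLE_injective hn ((key ξ hξ h1).trans (key δ hδ le_rfl).symm)

theorem MatchBelow.exists_halted {μ : Ordinal.{u}} (h : M.MatchBelow hn Γ y μ)
    {δ : Ordinal.{u}} (hδ : δ < μ) (hh : (M.simRun hn Γ y δ).state = (M.sim hn).halt) :
    ∃ β < μ, (M.supRun y β).state = M.halt := by
  obtain ⟨β, k, hle, -, hrun⟩ := h.phase_at hn hδ
  refine ⟨β, hle.trans_lt hδ, ?_⟩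
  by_contra hne
  rw [hrun] at hh
  exact phase_state_ne_halt hn hne hh

theorem supCell_limit {μ : Ordinal.{u}} (hμ : Order.IsSuccLimit μ)
    (hh : ∀ β < μ, (M.supRun y β).state ≠ M.halt) (c : ℕ) :
    (∃ β < μ, (M.supCell y c μ).ConstOn β μ ((M.supRun y μ).tape c)) ∨
      ((∀ β < μ, ∀ x, ¬ (M.supCell y c μ).ConstOn β μ x) ∧ (M.supRun y μ).tape c = 1) := by
  have hrun : M.supRun y μ = _ := run_limit_of_not_halted M LimitOperator.sup y hμ hh
  rw [hrun]
  by_cases h : ∃ β < μ, ∃ x, (M.supCell y c μ).ConstOn β μ x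
  · obtain ⟨β, hβ, x, hx⟩ := h
    left
    refine ⟨β, hβ, ?_⟩
    have : LimitOperator.sup (M.history LimitOperator.sup y μ) c = x :=
      LimitOperator.sup_apply_const (H := M.history LimitOperator.sup y μ) hβ hx
    simp only
    rwa [this]
  · push Not at h
    exact Or.inr ⟨h, LimitOperator.sup_apply_of_not_const
      (H := M.history LimitOperator.sup y μ) h⟩

theorem MatchBelow.mono {μ μ' : Ordinal.{u}} (h : M.MatchBelow hn Γ y μ) (hle : μ' ≤ μ) :
    M.MatchBelow hn Γ y μ' :=
  fun ν hν => h ν (hν.trans_le hle)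

/-- Before a halt, the cells of the emulating machine walk along the cycle of symbols. -/
theorem MatchBelow.isWalk_simCell {μ : Ordinal.{u}} (h : M.MatchBelow hn Γ y μ)
    (hh : ∀ β < μ, (M.supRun y β).state ≠ M.halt) (c : ℕ) :
    (M.simCell hn Γ y c μ).IsWalk (cycNext hn) (Fin.castLE hn 1) := by
  intro i hi hpos
  change i < μ at hi
  rcases Ordinal.zero_or_succ_or_isSuccLimit i with rfl | ⟨ν, rfl⟩ | hl
  · exact absurd hpos (lt_irrefl _)
  · left
    refine ⟨ν, Order.lt_succ ν, (M.simRun hn Γ y ν).tape c, ?_, ?_⟩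
    · intro ξ _ h1 h2
      obtain rfl := le_antisymm h1 (Order.lt_succ_iff.1 h2)
      rfl
    · obtain ⟨β, k, -, hk, hrun⟩ := h.phase_at hn ((Order.lt_succ ν).trans hi)
      have h1 : M.simRun hn Γ y (Order.succ ν) = (M.sim hn).step (M.simRun hn Γ y ν) :=
        run_add_one _ _ _ ν
      change (M.simRun hn Γ y (Order.succ ν)).tape c = _ ∨
        (M.simRun hn Γ y (Order.succ ν)).tape c = _
      obtain ⟨hk1, hk2⟩ := add_one_lt_of_le_delay hn hk
      rw [h1, hrun]
      exact step_phase_tape hn (by omega) hk1 hk2 c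
  · have hi' := h.mono hn hi.le
    have hget : (M.simCell hn Γ y c μ).get i hi = Fin.castLE hn ((M.supRun y i).tape c) := by
      change (M.simRun hn Γ y i).tape c = _
      rw [h i hi (Or.inr hl), phase_one_tape]
    rw [hget]
    -- If the cell of `M` has stabilized below `i`, so has the emulating cell, and its letter stays;
    -- otherwise neither has, and the value `1` of `sup` is the restart letter of the walk.
    rcases supCell_limit hl (fun β hβ => hh β (hβ.trans hi)) c with ⟨β, hβ, hx⟩ | ⟨hnot, h1⟩
    · obtain ⟨δ, hδ, hc⟩ := hi'.constOn_simCell hn hl hβ hx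
      exact Or.inl ⟨δ, hδ, _, fun ξ _ h1 h2 => hc ξ h2 h1 h2, Or.inl rfl⟩
    · refine Or.inr ⟨fun κ hκ z hz => ?_, by rw [h1]⟩
      obtain ⟨x, hx⟩ := hi'.constOn_supCell hn hl hκ (z := z)
        fun ξ hξ h1 h2 => hz ξ (hξ.trans hi) h1 h2
      exact hnot κ hκ x hx

/-- Induction on the stage: agreement below `μ` makes every emulating cell a walk up to `μ` unless
`M` has halted, and `IsCycleSup` then gives it the limit prescribed by `sup`. -/
theorem simRun_eq (hΓ : Γ.IsCycleSup hn) {μ : Ordinal.{u}} (hμ : μ = 0 ∨ Order.IsSuccLimit μ) :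
    M.simRun hn Γ y μ = phase hn M (M.supRun y μ) 1 := by
  induction μ using WellFoundedLT.induction with
  | ind μ ih =>
    rcases hμ with rfl | hμ
    · have h1 : M.simRun hn Γ y 0 = _ := run_zero _ _ _
      have h2 : M.supRun y 0 = _ := run_zero _ _ _
      rw [h1, h2]
      ext1
      · exact (phase_one_state hn (M.init y)).symm
      · rfl
      · funext c
        rw [phase_one_tape]
        change (if c % 3 = 0 then Fin.castLE hn (y (c / 3)) else 0)
          = Fin.castLE hn (if c % 3 = 0 then y (c / 3) else 0)
        split_ifs <;> rfl
    · have h : M.MatchBelow hn Γ y μ := fun ν hν hν' => ih ν hν hν'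
      by_cases hh : ∃ β < μ, (M.supRun y β).state = M.halt
      · obtain ⟨β, hβ, hhβ⟩ := hh
        obtain ⟨δ, hδ, -, hrun, -⟩ := h.phase_after hn hμ hβ
        have hhδ : (M.simRun hn Γ y δ).state = (M.sim hn).halt := by
          rw [hrun, phase_one_state, hhβ]
          rfl
        have h1 : M.simRun hn Γ y μ = M.simRun hn Γ y δ := run_of_halted _ _ _ hhδ hδ.le
        have h2 : M.supRun y μ = M.supRun y β := run_of_halted _ _ _ hhβ hβ.le
        rw [h1, h2, hrun]
      · have hh' : ∀ δ < μ, (M.simRun hn Γ y δ).state ≠ (M.sim hn).halt := fun δ hδ hd =>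
          hh (h.exists_halted hn hδ hd)
        have hh : ∀ β < μ, (M.supRun y β).state ≠ M.halt := fun β hβ hb => hh ⟨β, hβ, hb⟩
        have h1 : M.simRun hn Γ y μ = _ := run_limit_of_not_halted _ _ _ hμ hh'
        have h2 : M.supRun y μ = _ := run_limit_of_not_halted _ _ _ hμ hh
        ext1
        · rw [phase_one_state, h1, h2]
          rfl
        · change _ = (M.supRun y μ).head
          rw [h1, h2]
        · funext c
          rw [phase_one_tape, h1]
          rcases supCell_limit hμ hh c with ⟨β, hβ, hx⟩ | ⟨hnot, hone⟩
          · obtain ⟨δ, hδ, hc⟩ := h.constOn_simCell hn hμ hβ hx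
            exact hΓ.apply_const _ c δ _ hμ hδ hc
          · rw [hone]
            refine hΓ.apply_walk _ c hμ (h.isWalk_simCell hn hh c) fun κ hκ z hz => ?_
            obtain ⟨x, hx⟩ := h.constOn_supCell hn hμ hκ hz
            exact hnot κ hκ x hx

end Emulation
end Machine

theorem LimitOperator.IsCycleSup.emulates {n : ℕ} [NeZero n] {hn : 2 ≤ n}
    {Γ : LimitOperator.{u} n} (hΓ : Γ.IsCycleSup hn) : Emulates hn Γ LimitOperator.sup.{u} := by
  intro M
  refine ⟨M.sim hn, Sum.inl, Sum.inl_injective, rfl, rfl, rfl, fun y => ?_⟩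
  have hmatch : ∀ (s : Snapshot 2 M.State) (S : Snapshot n (M.sim hn).State),
      S = Machine.phase hn M s 1 → s.Matches hn Sum.inl S := by
    rintro s _ rfl
    exact ⟨Machine.phase_one_state hn s, rfl, Machine.phase_one_tape hn s⟩
  refine ⟨fun μ hμ => hmatch _ _ (Machine.simRun_eq hn hΓ (Or.inr hμ)), fun μ hμ => ?_⟩
  have h0 : (M.sim hn).run Γ (fun i => Fin.castLE hn (y i)) μ
      = Machine.phase hn M (M.run LimitOperator.sup y μ) 1 := Machine.simRun_eq hn hΓ hμ
  refine ⟨M.simTime n (M.run LimitOperator.sup y μ), M.simTime_strictMono _, rfl, ?_, ?_⟩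
  · intro j
    refine hmatch _ _ ?_
    rw [Machine.run_add_natCast, Machine.run_add_natCast, h0, Machine.iterate_step_simTime]
  · intro i hi
    obtain ⟨j, k, hk, rfl⟩ := M.exists_simTime_add_eq (n := n) (M.run LimitOperator.sup y μ) i
    rcases k with _ | k
    · exact absurd ⟨j, rfl⟩ hi
    -- An inserted snapshot has positive rank in a delay, which requires a rising cell; at rank `k +
    -- 1` that cell holds the symbol `k + 2`.
    · obtain ⟨hlt, c, hc⟩ := Machine.rises_of_lt_delay (Nat.lt_of_succ_le hk)
      refine ⟨c, ?_⟩
      rw [Machine.run_add_natCast, h0, Machine.iterate_step_simTime_add hn hk,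
        Machine.phase_tape_of_rises hn (by omega) hlt hc]
      change 2 ≤ k + 1 + 1
      omega

end InfTM

theorem mainTheorem8 (n : ℕ) [NeZero n] (hn : 2 ≤ n) (Γ : InfTM.LimitOperator.{u} n)
    (hΓ : Γ.Simulational) (hloop : Γ.LoopingStable) :
    ∃ σ : Equiv.Perm (Fin n),
      InfTM.Emulates hn (Γ.rename σ) InfTM.LimitOperator.sup.{u} := by
  obtain ⟨σ, hσ⟩ := hΓ.exists_isCycleSup_rename hn hloop
  exact ⟨σ, hσ.emulates⟩
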